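/- Let $A\in\mathbb{R}^{d\times d}$ be symmetric, $b\in\mathbb{R}^d$, $\rho>0$, and let $f(x)=\tfrac12 x^TAx+b^Tx+\tfrac{\rho}{3}\|x\|^3$, where $\|\cdot\|$ is the Euclidean norm. Let $s$ be a global minimizer of $f$ on $\mathbb{R}^d$, let $\beta\ge\|A\|_{\mathrm{op}}$ (for instance $\beta=\|A\|_{\mathrm{op}}$, the $\ell_2$ operator norm), let $\lambda_{\min}$ be the smallest eigenvalue of $A$, let $v_{\min}$ be a corresponding unit eigenvector, and suppose that $b^{(1)}:=v_{\min}^Tb\neq0$. Put $$R_\rho=\frac{\beta}{2\rho}+\sqrt{\Big(\frac{\beta}{2\rho}\Big)^2+\frac{\|b\|}{\rho}},\qquad R_{\mathrm c}=-\frac{b^TAb}{2\rho\|b\|^2}+\sqrt{\Big(\frac{b^TAb}{2\rho\|b\|^2}\Big)^2+\frac{\|b\|}{\rho}}.$$ Let $x_0=-r\,b/\|b\|$ with $0\le r\le R_{\mathrm c}$, let $0<\eta\le\frac{1}{4(\beta+\rho R_\rho)}$, and let $x_{t+1}=x_t-\eta\nabla f(x_t)$ for $t=0,1,2,\dots$.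 Let $\varepsilon>0$ and define, with $(u)_+=\max\{u,0\}$, $$\tau_{\mathrm{grow}}=6\log\Big(1+\frac{(-\lambda_{\min})_+^2}{4\rho|b^{(1)}|}\Big),\qquad \tau_{\mathrm{converge}}(\varepsilon)=6\log\Big(\frac{(\beta+2\rho\|s\|)\|s\|^2}{\varepsilon}\Big).$$ Then $f(x_t)\le f(s)+\varepsilon$ for every integer $t\ge0$ with $$t\ \ge\ \frac{\tau_{\mathrm{grow}}+\tau_{\mathrm{converge}}(\varepsilon)}{\eta}\, \min\Big\{\frac{1}{\rho\|s\|+\lambda_{\min}},\ \frac{10\|s\|^2}{\varepsilon}\Big\}.$$ -/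

import Mathlib

open scoped InnerProductSpace Gradient

noncomputable section

namespace CubicGD

variable {d : ℕ}

/-- The operator `x ↦ A x` on `ℝ^d` with the Euclidean norm; its norm is `‖A‖_op`. -/
abbrev op (A : Matrix (Fin d) (Fin d) ℝ) :
    EuclideanSpace ℝ (Fin d) →L[ℝ] EuclideanSpace ℝ (Fin d) :=
  Matrix.toEuclideanCLM (𝕜 := ℝ) A

/-- The cubic-regularized quadratic `f(x) = ½ xᵀAx + bᵀx + (ρ/3)‖x‖³`. -/
def objective (A : Matrix (Fin d) (Fin d) ℝ) (b : EuclideanSpace ℝ (Fin d)) (ρ : ℝ)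
    (x : EuclideanSpace ℝ (Fin d)) : ℝ :=
  1 / 2 * ⟪x, op A x⟫_ℝ + ⟪b, x⟫_ℝ + ρ / 3 * ‖x‖ ^ 3

/-- Gradient descent with constant step size `η` started at `x₀`:
`x_{t+1} = x_t - η ∇f(x_t)`. -/
def gradientDescent (f : EuclideanSpace ℝ (Fin d) → ℝ) (η : ℝ)
    (x₀ : EuclideanSpace ℝ (Fin d)) : ℕ → EuclideanSpace ℝ (Fin d)
  | 0 => x₀
  | t + 1 => gradientDescent f η x₀ t - η • ∇ f (gradientDescent f η x₀ t)

/-- `IsMinEigenvalue A μ`: `μ` is the smallest eigenvalue of `A`. -/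
def IsMinEigenvalue (A : Matrix (Fin d) (Fin d) ℝ) (μ : ℝ) : Prop :=
  IsLeast {μ' : ℝ | Module.End.HasEigenvalue (Matrix.toEuclideanLin A) μ'} μ

/-- The upper bound `R_ρ` on the norm of a minimizer. -/
def upperRadius (β ρ : ℝ) (b : EuclideanSpace ℝ (Fin d)) : ℝ :=
  β / (2 * ρ) + √((β / (2 * ρ)) ^ 2 + ‖b‖ / ρ)

/-- The Cauchy radius `R_c`: `-R_c b/‖b‖` minimizes the objective on the line spanned by `b`. -/
def cauchyRadius (A : Matrix (Fin d) (Fin d) ℝ) (b : EuclideanSpace ℝ (Fin d)) (ρ : ℝ) : ℝ :=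
  -⟪b, op A b⟫_ℝ / (2 * ρ * ‖b‖ ^ 2)
    + √((⟪b, op A b⟫_ℝ / (2 * ρ * ‖b‖ ^ 2)) ^ 2 + ‖b‖ / ρ)

/-- `τ_grow = 6 log (1 + (-λ_min)₊² / (4 ρ |b⁽¹⁾|))`. -/
def tauGrow (lamMin ρ b₁ : ℝ) : ℝ :=
  6 * Real.log (1 + (max (-lamMin) 0) ^ 2 / (4 * ρ * |b₁|))

/-- `τ_converge(ε) = 6 log ((β + 2ρ‖s‖) ‖s‖² / ε)`. -/
def tauConverge (β ρ normS ε : ℝ) : ℝ :=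
  6 * Real.log ((β + 2 * ρ * normS) * normS ^ 2 / ε)

end CubicGD

end

/-!
A finite segment of the run lies in a finite-dimensional subspace, so `A` may be compressed to it
and diagonalized. In the eigenbasis every coordinate of an iterate stays a nonpositive multiple of
the same coordinate of `b`, and directions of smaller curvature keep more slack; a Chebyshev-type
comparison then shows `⟪x t, ∇f (x t)⟫ ≤ 0` for all `t`. Hence the norms `‖x t‖` increase, and they
never leave the ball of radius `R_ρ`.

While `ρ‖x t‖ + λ_min` is negative, the component of `x t` along `v_min` grows geometrically, which
can last only about `τ_grow / (η g)` steps before `ρ‖x t‖ + λ_min ≥ -g / 3`; here `g > 0` is a free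
rate. For `g = ρ‖s‖ + λ_min` the gradient step contracts towards `s` from then on, so `x t → s`,
`‖x t‖ ≤ ‖s‖`, and the model converges linearly. For `g = ε / (10‖s‖²)` the model is convex up to
an error proportional to `ε`, and the usual convex argument bounds the number of remaining steps.
-/

namespace CubicGD

/-! ### Roots of quadratics -/

/-- The larger root of `t ^ 2 = 2 * a * t + c`; both radii of the theorem are of this form. -/
noncomputable def largerRoot (a c : ℝ) : ℝ := a + √(a ^ 2 + c)

lemma largerRoot_sq {a c : ℝ} (hc : 0 ≤ c) :
    largerRoot a c ^ 2 = 2 * a * largerRoot a c + c := by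
  have hsq := Real.sq_sqrt (show 0 ≤ a ^ 2 + c by positivity)
  unfold largerRoot
  linear_combination hsq

lemma le_largerRoot_iff {a c t : ℝ} (hc : 0 ≤ c) (ht : 0 ≤ t) :
    t ≤ largerRoot a c ↔ t ^ 2 ≤ 2 * a * t + c := by
  have habs : |a| ≤ √(a ^ 2 + c) := Real.abs_le_sqrt (le_add_of_nonneg_right hc)
  have hlower : -√(a ^ 2 + c) ≤ t - a := by linarith [le_abs_self a]
  calc t ≤ largerRoot a c ↔ |t - a| ≤ √(a ^ 2 + c) := by
        rw [abs_le, and_iff_right hlower, sub_le_iff_le_add', largerRoot]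
    _ ↔ (t - a) ^ 2 ≤ a ^ 2 + c := by
        rw [Real.le_sqrt (abs_nonneg _) (by positivity), sq_abs]
    _ ↔ t ^ 2 ≤ 2 * a * t + c := by constructor <;> intro h <;> linarith

section TrapRadius

variable {E : Type*} [NormedAddCommGroup E] {β ρ : ℝ} {b : E}

/-- The radius `R_ρ` of a ball that contains every point at which the model does not increase
radially, in particular every critical point. -/
noncomputable def trapRadius (β ρ : ℝ) (b : E) : ℝ :=
  β / (2 * ρ) + √((β / (2 * ρ)) ^ 2 + ‖b‖ / ρ)

lemma trapRadius_eq_largerRoot (β ρ : ℝ) (b : E) :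
    trapRadius β ρ b = largerRoot (β / (2 * ρ)) (‖b‖ / ρ) := rfl

lemma mul_trapRadius_sq (hρ : 0 < ρ) (β : ℝ) (b : E) :
    ρ * trapRadius β ρ b ^ 2 = β * trapRadius β ρ b + ‖b‖ := by
  rw [trapRadius_eq_largerRoot, largerRoot_sq (by positivity)]
  field_simp

lemma trapRadius_pos (hβ : 0 ≤ β) (hρ : 0 < ρ) (hb : b ≠ 0) : 0 < trapRadius β ρ b := by
  have hroot : 0 < √((β / (2 * ρ)) ^ 2 + ‖b‖ / ρ) := Real.sqrt_pos.2 (by positivity)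
  exact add_pos_of_nonneg_of_pos (by positivity) hroot

end TrapRadius

/-! ### Coordinates relative to the linear term -/

section Coordinates

variable {ι : Type*}

/-- Write a point as `x i = -(b i * y i)` in an orthonormal eigenbasis, and let `a i` be the `i`-th
eigenvalue shifted by `ρ * ‖x‖`. Then `b i * slack a y i` is the `i`-th coordinate of the gradient
at `x`. Working with `y` avoids dividing by `b i`, which may vanish. -/
def slack (a y : ι → ℝ) (i : ι) : ℝ := 1 - a i * y i

/-- The effect of a gradient step of size `η` on the coordinates `y` of `slack`. -/
def coordStep (η : ℝ) (a y : ι → ℝ) (i : ι) : ℝ := y i + η * slack a y i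

/-- Positive slack in an eigendirection forces positive slack, no smaller relative to `y`, in every
direction of smaller curvature. -/
def SlackOrdered (a y : ι → ℝ) : Prop :=
  ∀ i j, a i ≤ a j → 0 < slack a y j → 0 < slack a y i ∧ slack a y j * y i ≤ slack a y i * y j

variable {a y : ι → ℝ} {η c : ℝ}

lemma slackOrdered_const (a : ι → ℝ) {y₀ : ℝ} (hy₀ : 0 ≤ y₀) :
    SlackOrdered a (fun _ => y₀) := by
  intro i j hij hj
  have hle : slack a (fun _ => y₀) j ≤ slack a (fun _ => y₀) i :=
    sub_le_sub_left (mul_le_mul_of_nonneg_right hij hy₀) 1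
  exact ⟨hj.trans_le hle, mul_le_mul_of_nonneg_right hle hy₀⟩

lemma coordStep_pos {i : ι} (hη : 0 < η) (hy : 0 ≤ y i) (ha : η * a i ≤ 1) :
    0 < coordStep η a y i := by
  have hconv : coordStep η a y i = (1 - η * a i) * y i + η := by
    unfold coordStep slack
    ring
  rw [hconv]
  exact add_pos_of_nonneg_of_pos (mul_nonneg (sub_nonneg.2 ha) hy) hη

lemma slack_add_const_coordStep (a y : ι → ℝ) (η c : ℝ) (i : ι) :
    slack (fun i => a i + c) (coordStep η a y) i =
      (1 - η * a i) * slack a y i - c * coordStep η a y i := by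
  unfold coordStep slack
  ring

lemma SlackOrdered.coordStep (hη : 0 < η) (hc : 0 ≤ c) (hy : ∀ i, 0 ≤ y i)
    (ha : ∀ i, η * a i ≤ 1) (h : SlackOrdered a y) :
    SlackOrdered (fun i => a i + c) (coordStep η a y) := by
  intro i j hij hj
  have haij : a i ≤ a j := le_of_add_le_add_right hij
  have hyi := coordStep_pos hη (hy i) (ha i)
  have hyj := coordStep_pos hη (hy j) (ha j)
  have hfac : ∀ i, 0 ≤ 1 - η * a i := fun i => sub_nonneg.2 (ha i)
  have hprod : 0 < (1 - η * a j) * slack a y j := by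
    rw [slack_add_const_coordStep] at hj
    linarith [mul_nonneg hc hyj.le]
  have hslack : 0 < slack a y j := pos_of_mul_pos_right hprod (hfac j)
  obtain ⟨-, hratio⟩ := h i j haij hslack
  have hstep : slack a y j * CubicGD.coordStep η a y i
      ≤ slack a y i * CubicGD.coordStep η a y j := by
    unfold CubicGD.coordStep
    linarith
  have hfactor : (1 - η * a j) * (slack a y j * CubicGD.coordStep η a y i)
      ≤ (1 - η * a i) * (slack a y i * CubicGD.coordStep η a y j) :=
    mul_le_mul (by gcongr) hstep (by positivity) (hfac i)
  have hmain : slack (fun i => a i + c) (CubicGD.coordStep η a y) j * CubicGD.coordStep η a y i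
      ≤ slack (fun i => a i + c) (CubicGD.coordStep η a y) i * CubicGD.coordStep η a y j := by
    rw [slack_add_const_coordStep, slack_add_const_coordStep]
    linarith
  exact ⟨pos_of_mul_pos_left ((mul_pos hj hyi).trans_le hmain) hyj.le, hmain⟩

lemma SlackOrdered.exists_threshold [Finite ι] [Nonempty ι] (h : SlackOrdered a y) :
    ∃ k, ∀ i, (0 < slack a y i → a i ≤ a k) ∧ (slack a y i ≤ 0 → a k ≤ a i) := by
  rcases {i | 0 < slack a y i}.eq_empty_or_nonempty with hempty | hne
  · obtain ⟨k, hk⟩ := Finite.exists_min a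
    exact ⟨k, fun i => ⟨fun hi => absurd hi (Set.eq_empty_iff_forall_notMem.1 hempty i),
      fun _ => hk i⟩⟩
  · obtain ⟨k, hk, hmax⟩ := Set.exists_max_image _ a (Set.toFinite _) hne
    refine ⟨k, fun i => ⟨hmax i, fun hi => ?_⟩⟩
    by_contra! hlt
    exact hi.not_gt (h i k hlt.le hk).1

lemma slack_mul_le_slack_mul_coordStep {u : ι → ℝ} {i k : ι} (hη : 0 ≤ η) (hy : 0 ≤ y i)
    (hy' : 0 ≤ coordStep η a y i) (hu : ∀ i, 0 ≤ u i)
    (hpos : 0 < slack a y i → u k ≤ u i) (hneg : slack a y i ≤ 0 → u i ≤ u k) :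
    slack a y i * (y i * u k) ≤ slack a y i * (coordStep η a y i * u i) := by
  rcases lt_or_ge 0 (slack a y i) with h | h
  · have hgrow : y i ≤ coordStep η a y i := le_add_of_nonneg_right (by positivity)
    exact mul_le_mul_of_nonneg_left (mul_le_mul hgrow (hpos h) (hu k) hy') h.le
  · have hshrink : coordStep η a y i ≤ y i :=
      add_le_of_nonpos_right (mul_nonpos_of_nonneg_of_nonpos hη h)
    exact mul_le_mul_of_nonpos_left (mul_le_mul hshrink (hneg h) (hu i) hy) h

lemma sum_mul_slack_coordStep [Fintype ι] (B a y : ι → ℝ) {η c κ : ℝ}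
    (hκ : c * ∑ i, B i * coordStep η a y i ^ 2 =
      κ * (∑ i, B i * coordStep η a y i ^ 2 - ∑ i, B i * y i ^ 2)) :
    ∑ i, B i * (coordStep η a y i * slack (fun i => a i + c) (coordStep η a y) i) =
      ∑ i, B i * (slack a y i * (coordStep η a y i * (1 - η * a i - κ * η) - κ * η * y i)) := by
  calc ∑ i, B i * (coordStep η a y i * slack (fun i => a i + c) (coordStep η a y) i)
      = ∑ i, B i * (coordStep η a y i * ((1 - η * a i) * slack a y i))
          - c * ∑ i, B i * coordStep η a y i ^ 2 := by
        rw [Finset.mul_sum, ← Finset.sum_sub_distrib]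
        exact Finset.sum_congr rfl fun i _ => by rw [slack_add_const_coordStep]; ring
    _ = _ := by
        rw [hκ, ← Finset.sum_sub_distrib, Finset.mul_sum, ← Finset.sum_sub_distrib]
        exact Finset.sum_congr rfl fun i _ => by unfold coordStep; ring

/-- A Chebyshev-type argument: positive slacks sit at the smaller `a i`, where the step multiplies
them by the larger factors. -/
lemma SlackOrdered.sum_mul_slack_coordStep_nonneg [Fintype ι] {B : ι → ℝ} {κ : ℝ}
    (hη : 0 < η) (hκ₀ : 0 ≤ κ) (hB : ∀ i, 0 ≤ B i) (hy : ∀ i, 0 ≤ y i)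
    (ha : ∀ i, η * (a i + 2 * κ) ≤ 1)
    (hκ : c * ∑ i, B i * CubicGD.coordStep η a y i ^ 2 =
      κ * (∑ i, B i * CubicGD.coordStep η a y i ^ 2 - ∑ i, B i * y i ^ 2))
    (h : SlackOrdered a y) (hsum : 0 ≤ ∑ i, B i * (y i * slack a y i)) :
    0 ≤ ∑ i, B i *
      (CubicGD.coordStep η a y i * slack (fun i => a i + c) (CubicGD.coordStep η a y) i) := by
  rcases isEmpty_or_nonempty ι with hι | hι
  · simp
  obtain ⟨k, hk⟩ := h.exists_threshold
  have hκη : 0 ≤ κ * η := mul_nonneg hκ₀ hη.le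
  have hfac : ∀ i, 0 ≤ 1 - η * a i - 2 * (κ * η) := fun i => by linarith [ha i]
  rw [sum_mul_slack_coordStep B a y hκ]
  calc 0 ≤ (1 - η * a k - 2 * (κ * η)) * ∑ i, B i * (y i * slack a y i) :=
        mul_nonneg (hfac k) hsum
    _ = ∑ i, B i * (slack a y i * (y i * (1 - η * a k - κ * η) - κ * η * y i)) := by
        rw [Finset.mul_sum]
        exact Finset.sum_congr rfl fun i _ => by ring
    _ ≤ _ := by
        refine Finset.sum_le_sum fun i _ => mul_le_mul_of_nonneg_left ?_ (hB i)
        have hle := slack_mul_le_slack_mul_coordStep (a := a) (y := y) (i := i) (k := k)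
          (u := fun i => 1 - η * a i - κ * η) hη.le (hy i)
          (coordStep_pos hη (hy i) (by linarith [hfac i])).le (fun i => by linarith [hfac i])
          (fun hi => by linarith [mul_le_mul_of_nonneg_left ((hk i).1 hi) hη.le])
          (fun hi => by linarith [mul_le_mul_of_nonneg_left ((hk i).2 hi) hη.le])
        linarith

lemma exists_mul_sub_mul_sq_eq {n n' : ℝ} (hn : 0 ≤ n) (hn' : 0 ≤ n') :
    ∃ κ, 0 ≤ κ ∧ κ ≤ n' ∧ (n' - n) * n' ^ 2 = κ * (n' ^ 2 - n ^ 2) := by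
  rcases (add_nonneg hn' hn).eq_or_lt with hzero | hpos
  · have hn'₀ : n' = 0 := by linarith
    have hn₀ : n = 0 := by linarith
    exact ⟨0, le_rfl, hn', by simp [hn₀, hn'₀]⟩
  · refine ⟨n' ^ 2 / (n' + n), by positivity, ?_, ?_⟩
    · rw [div_le_iff₀ hpos, sq]
      exact mul_le_mul_of_nonneg_left (le_add_of_nonneg_right hn) hn'
    · field_simp
      ring

end Coordinates

/-! ### The cubic model -/

section Model

variable {E : Type*} [NormedAddCommGroup E]

lemma norm_sub_sq_le_four_mul {x s : E} (hxs : ‖x‖ ≤ ‖s‖) : ‖x - s‖ ^ 2 ≤ 4 * ‖s‖ ^ 2 :=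
  calc ‖x - s‖ ^ 2 ≤ (2 * ‖s‖) ^ 2 := by
        gcongr
        linarith [norm_sub_le x s]
    _ = 4 * ‖s‖ ^ 2 := by ring

variable [InnerProductSpace ℝ E]

lemma norm_sub_smul_sq (w g : E) (η : ℝ) :
    ‖w - η • g‖ ^ 2 = ‖w‖ ^ 2 - 2 * η * ⟪w, g⟫_ℝ + η ^ 2 * ‖g‖ ^ 2 := by
  rw [norm_sub_sq_real, inner_smul_right, norm_smul, mul_pow, Real.norm_eq_abs, sq_abs]
  ring

lemma norm_le_norm_sub_smul {x g : E} {η : ℝ} (hη : 0 ≤ η) (hxg : ⟪x, g⟫_ℝ ≤ 0) :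
    ‖x‖ ≤ ‖x - η • g‖ := by
  rw [← sq_le_sq₀ (norm_nonneg _) (norm_nonneg _), norm_sub_smul_sq]
  linarith [mul_nonpos_of_nonneg_of_nonpos hη hxg, mul_nonneg (sq_nonneg η) (sq_nonneg ‖g‖)]

lemma mul_norm_sq_apply_le_inner {S : E →L[ℝ] E} (hS : S.IsSymmetric) {t : ℝ} (ht : 0 ≤ t)
    (hpos : ∀ z, 0 ≤ ⟪z, S z⟫_ℝ) (hle : ∀ z, t * ⟪z, S z⟫_ℝ ≤ ‖z‖ ^ 2) (x : E) :
    t * ‖S x‖ ^ 2 ≤ ⟪x, S x⟫_ℝ := by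
  have hexpand : ⟪x - t • S x, S (x - t • S x)⟫_ℝ =
      ⟪x, S x⟫_ℝ - 2 * t * ‖S x‖ ^ 2 + t * (t * ⟪S x, S (S x)⟫_ℝ) := by
    simp only [map_sub, map_smul, inner_sub_left, inner_sub_right, real_inner_smul_left,
      real_inner_smul_right, ← hS.apply_clm x, real_inner_self_eq_norm_sq]
    ring
  linarith [hpos (x - t • S x), mul_le_mul_of_nonneg_left (hle (S x)) ht]

variable {T : E →L[ℝ] E} {b s x v : E} {ρ β R η m μ : ℝ}

lemma inner_apply_eigenvector (hT : T.IsSymmetric) (hTv : T v = μ • v) (x : E) :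
    ⟪v, T x⟫_ℝ = μ * ⟪v, x⟫_ℝ := by
  rw [← hT.apply_clm, hTv, real_inner_smul_left]

lemma abs_inner_apply_le (hβ : ‖T‖ ≤ β) (x : E) : |⟪x, T x⟫_ℝ| ≤ β * ‖x‖ ^ 2 :=
  calc |⟪x, T x⟫_ℝ| ≤ ‖x‖ * ‖T x‖ := abs_real_inner_le_norm x (T x)
    _ ≤ ‖x‖ * (β * ‖x‖) := by
        gcongr
        exact T.le_of_opNorm_le hβ x
    _ = β * ‖x‖ ^ 2 := by ring

lemma eigenvalue_le_of_opNorm_le (hβ : ‖T‖ ≤ β) (hv : ‖v‖ = 1) (hTv : T v = μ • v) : μ ≤ β := by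
  have hle := (abs_le.1 (abs_inner_apply_le hβ v)).2
  simpa only [hTv, real_inner_smul_right, real_inner_self_eq_norm_sq, hv, one_pow, mul_one]
    using hle

/-- The cubic-regularized quadratic `½⟪x, T x⟫ + ⟪b, x⟫ + (ρ/3)‖x‖³` on an inner product space. -/
noncomputable def cubicModel (T : E →L[ℝ] E) (b : E) (ρ : ℝ) (x : E) : ℝ :=
  1 / 2 * ⟪x, T x⟫_ℝ + ⟪b, x⟫_ℝ + ρ / 3 * ‖x‖ ^ 3

/-- The gradient of `cubicModel T b ρ`, provided that `T` is symmetric. -/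
noncomputable def cubicGrad (T : E →L[ℝ] E) (b : E) (ρ : ℝ) (x : E) : E :=
  T x + b + (ρ * ‖x‖) • x

lemma inner_cubicGrad (T : E →L[ℝ] E) (b : E) (ρ : ℝ) (x y : E) :
    ⟪y, cubicGrad T b ρ x⟫_ℝ = ⟪y, T x⟫_ℝ + ⟪y, b⟫_ℝ + ρ * ‖x‖ * ⟪y, x⟫_ℝ := by
  rw [cubicGrad, inner_add_right, inner_add_right, real_inner_smul_right]

lemma hasFDerivAt_norm_cube (x : E) :
    HasFDerivAt (fun x : E => ‖x‖ ^ 3) ((3 * ‖x‖) • innerSL ℝ x) x := by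
  have hrpow := hasFDerivAt_norm_rpow x (p := 3) (by norm_num)
  rw [show (3 : ℝ) - 2 = 1 by norm_num, Real.rpow_one] at hrpow
  exact_mod_cast hrpow

lemma hasFDerivAt_cubicModel (hT : T.IsSymmetric) (b : E) (ρ : ℝ) (x : E) :
    HasFDerivAt (cubicModel T b ρ) (innerSL ℝ (cubicGrad T b ρ x)) x := by
  have hquad : HasFDerivAt (fun x => ⟪x, T x⟫_ℝ) _ x := (hasFDerivAt_id x).inner ℝ T.hasFDerivAt
  have hsum := ((hquad.const_mul (1 / 2)).add (innerSL ℝ b).hasFDerivAt).add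
    ((hasFDerivAt_norm_cube x).const_mul (ρ / 3))
  refine hsum.congr_fderiv ?_
  ext y
  have hswap : ⟪x, T y⟫_ℝ = ⟪T x, y⟫_ℝ := (hT.apply_clm x y).symm
  simp only [cubicGrad, map_add, map_smul, fderivInnerCLM_apply, add_apply, smul_apply,
    innerSL_apply_apply, smul_eq_mul, ContinuousLinearMap.comp_apply,
    ContinuousLinearMap.prod_apply, ContinuousLinearMap.id_apply, id_eq, hswap,
    real_inner_comm y (T x)]
  ring

lemma hasGradientAt_cubicModel [CompleteSpace E] (hT : T.IsSymmetric) (b : E) (ρ : ℝ) (x : E) :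
    HasGradientAt (cubicModel T b ρ) (cubicGrad T b ρ x) x :=
  hasGradientAt_iff_hasFDerivAt.2 (hasFDerivAt_cubicModel hT b ρ x)

lemma cubicGrad_eq_zero_of_forall_le (hT : T.IsSymmetric)
    (hs : ∀ x, cubicModel T b ρ s ≤ cubicModel T b ρ x) : cubicGrad T b ρ s = 0 := by
  have hzero : innerSL ℝ (cubicGrad T b ρ s) = 0 :=
    IsLocalMin.hasFDerivAt_eq_zero (.of_forall hs) (hasFDerivAt_cubicModel hT b ρ s)
  rw [← norm_eq_zero, ← innerSL_apply_norm ℝ, hzero, norm_zero]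

lemma cubicModel_add (hT : T.IsSymmetric) (b : E) (ρ : ℝ) (x p : E) :
    cubicModel T b ρ (x + p) = cubicModel T b ρ x + ⟪cubicGrad T b ρ x, p⟫_ℝ
      + 1 / 2 * (⟪p, T p⟫_ℝ + ρ * ‖x‖ * ‖p‖ ^ 2)
      + ρ / 6 * (‖x + p‖ - ‖x‖) ^ 2 * (2 * ‖x + p‖ + ‖x‖) := by
  have hxp : ⟪x, p⟫_ℝ = (‖x + p‖ ^ 2 - ‖x‖ ^ 2 - ‖p‖ ^ 2) / 2 := by
    linarith [norm_add_sq_real x p]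
  rw [real_inner_comm, inner_cubicGrad, real_inner_comm x p, hxp]
  unfold cubicModel
  simp only [map_add, inner_add_left, inner_add_right, ← hT.apply_clm x p,
    real_inner_comm (T x) p, real_inner_comm b p]
  ring

lemma cubicModel_eq_of_cubicGrad_eq_zero (hT : T.IsSymmetric) (hs : cubicGrad T b ρ s = 0)
    (x : E) :
    cubicModel T b ρ x = cubicModel T b ρ s
      + 1 / 2 * (⟪x - s, T (x - s)⟫_ℝ + ρ * ‖s‖ * ‖x - s‖ ^ 2)
      + ρ / 6 * (‖x‖ - ‖s‖) ^ 2 * (2 * ‖x‖ + ‖s‖) := by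
  simpa only [add_sub_cancel, hs, inner_zero_left, add_zero] using cubicModel_add hT b ρ s (x - s)

lemma cubicGrad_eq_add_of_cubicGrad_eq_zero (hs : cubicGrad T b ρ s = 0) (x : E) :
    cubicGrad T b ρ x = (T (x - s) + (ρ / 2 * (‖x‖ + ‖s‖)) • (x - s))
      + (ρ / 2 * (‖x‖ - ‖s‖)) • (x + s) := by
  have hsub : cubicGrad T b ρ x = cubicGrad T b ρ x - cubicGrad T b ρ s := by rw [hs, sub_zero]
  rw [hsub, cubicGrad, cubicGrad, map_sub]
  module

lemma inner_sub_cubicGrad (hs : cubicGrad T b ρ s = 0) (x : E) :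
    ⟪x - s, cubicGrad T b ρ x⟫_ℝ = ⟪x - s, T (x - s)⟫_ℝ + ρ / 2 * (‖x‖ + ‖s‖) * ‖x - s‖ ^ 2
      + ρ / 2 * (‖s‖ - ‖x‖) ^ 2 * (‖x‖ + ‖s‖) := by
  have hadd : ⟪x - s, x + s⟫_ℝ = ‖x‖ ^ 2 - ‖s‖ ^ 2 := by
    rw [inner_sub_left, inner_add_right, inner_add_right, real_inner_self_eq_norm_sq,
      real_inner_self_eq_norm_sq, real_inner_comm x s]
    ring
  rw [cubicGrad_eq_add_of_cubicGrad_eq_zero hs, inner_add_right, inner_add_right,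
    real_inner_smul_right, real_inner_smul_right, real_inner_self_eq_norm_sq, hadd]
  ring

/-- Reflecting a minimizer in the hyperplane `vᗮ` keeps its norm, so the change of the model is
governed by the shifted eigenvalue alone. -/
lemma shifted_eigenvalue_pos (hT : T.IsSymmetric)
    (hs : ∀ x, cubicModel T b ρ s ≤ cubicModel T b ρ x) (hv : ‖v‖ = 1) (hTv : T v = μ • v)
    (hb : ⟪v, b⟫_ℝ ≠ 0) : 0 < ρ * ‖s‖ + μ := by
  have hgrad := cubicGrad_eq_zero_of_forall_le hT hs
  have hcoord : (ρ * ‖s‖ + μ) * ⟪v, s⟫_ℝ = -⟪v, b⟫_ℝ := by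
    have hzero := inner_cubicGrad T b ρ s v
    rw [hgrad, inner_zero_right, inner_apply_eigenvector hT hTv] at hzero
    linarith
  have hne : (ρ * ‖s‖ + μ) * ⟪v, s⟫_ℝ ≠ 0 := hcoord ▸ neg_ne_zero.2 hb
  have hvs : ⟪v, s⟫_ℝ ≠ 0 := right_ne_zero_of_mul hne
  have hreflect : ‖s - (2 * ⟪v, s⟫_ℝ) • v‖ = ‖s‖ := by
    rw [← sq_eq_sq₀ (norm_nonneg _) (norm_nonneg _), norm_sub_smul_sq, hv, real_inner_comm]
    ring
  have hmodel := cubicModel_eq_of_cubicGrad_eq_zero hT hgrad (s - (2 * ⟪v, s⟫_ℝ) • v)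
  rw [hreflect, sub_sub_cancel_left, ← neg_smul, map_smul, hTv, norm_smul, hv,
    real_inner_smul_left, real_inner_smul_right, real_inner_smul_right,
    real_inner_self_eq_norm_sq, hv, Real.norm_eq_abs, mul_one, sq_abs] at hmodel
  have hnonneg : 0 ≤ (ρ * ‖s‖ + μ) * (2 * ⟪v, s⟫_ℝ ^ 2) := by
    linarith [hs (s - (2 * ⟪v, s⟫_ℝ) • v)]
  exact (nonneg_of_mul_nonneg_left hnonneg (by positivity)).lt_of_ne'
    (left_ne_zero_of_mul hne)

lemma cubicModel_nonpos (hρ : 0 ≤ ρ) (hbx : ⟪b, x⟫_ℝ ≤ 0)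
    (hx : ⟪x, cubicGrad T b ρ x⟫_ℝ ≤ 0) : cubicModel T b ρ x ≤ 0 := by
  have hcube : 0 ≤ ρ * ‖x‖ ^ 3 := by positivity
  rw [inner_cubicGrad, real_inner_self_eq_norm_sq, real_inner_comm b x] at hx
  unfold cubicModel
  linarith

lemma norm_cubicGrad_le (hρ : 0 ≤ ρ) (hβ : ‖T‖ ≤ β) (x : E) :
    ‖cubicGrad T b ρ x‖ ≤ β * ‖x‖ + ‖b‖ + ρ * ‖x‖ ^ 2 :=
  calc ‖cubicGrad T b ρ x‖ ≤ ‖T x‖ + ‖b‖ + ‖(ρ * ‖x‖) • x‖ := norm_add₃_le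
    _ ≤ β * ‖x‖ + ‖b‖ + ρ * ‖x‖ * ‖x‖ := by
        rw [norm_smul, Real.norm_of_nonneg (by positivity)]
        gcongr
        exact T.le_of_opNorm_le hβ x
    _ = β * ‖x‖ + ‖b‖ + ρ * ‖x‖ ^ 2 := by ring

lemma cubicModel_le_of_norm_le (hT : T.IsSymmetric) (hρ : 0 ≤ ρ) (hβ : ‖T‖ ≤ β)
    (hs : cubicGrad T b ρ s = 0) (hx : ‖x‖ ≤ ‖s‖) :
    cubicModel T b ρ x ≤ cubicModel T b ρ s + 1 / 2 * (β + 2 * ρ * ‖s‖) * ‖x - s‖ ^ 2 := by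
  have hquad := (abs_le.1 (abs_inner_apply_le hβ (x - s))).2
  have hnorm : (‖x‖ - ‖s‖) ^ 2 ≤ ‖x - s‖ ^ 2 := sq_le_sq.2 <| by
    rw [abs_norm]
    exact abs_norm_sub_norm_le x s
  have hcubic : ρ / 6 * (‖x‖ - ‖s‖) ^ 2 * (2 * ‖x‖ + ‖s‖)
      ≤ ρ / 6 * ‖x - s‖ ^ 2 * (2 * ‖s‖ + ‖s‖) := by gcongr
  rw [cubicModel_eq_of_cubicGrad_eq_zero hT hs]
  linarith

lemma neg_cubicModel_le (hT : T.IsSymmetric) (hρ : 0 ≤ ρ) (hβ : ‖T‖ ≤ β)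
    (hs : cubicGrad T b ρ s = 0) :
    -cubicModel T b ρ s ≤ 1 / 2 * ((β + 2 * ρ * ‖s‖) * ‖s‖ ^ 2) := by
  have hzero : cubicModel T b ρ 0 = 0 := by simp [cubicModel]
  have hle := cubicModel_le_of_norm_le hT hρ hβ hs (x := 0) (by simp)
  rw [hzero, zero_sub, norm_neg] at hle
  linarith

/-! ### Single gradient steps -/

lemma cubicModel_sub_smul_cubicGrad_le (hT : T.IsSymmetric) (hρ : 0 ≤ ρ) (hβ : ‖T‖ ≤ β)
    (hη : 0 ≤ η) (hηR : 4 * η * (β + ρ * R) ≤ 1) (hx : ‖x‖ ≤ R)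
    (hx' : ‖x - η • cubicGrad T b ρ x‖ ≤ R) :
    cubicModel T b ρ (x - η • cubicGrad T b ρ x) + 3 / 4 * η * ‖cubicGrad T b ρ x‖ ^ 2
      ≤ cubicModel T b ρ x := by
  have hexpand := cubicModel_add hT b ρ x (-(η • cubicGrad T b ρ x))
  set G := cubicGrad T b ρ x
  have hβ₀ : 0 ≤ β := (norm_nonneg T).trans hβ
  have hR₀ : 0 ≤ R := (norm_nonneg x).trans hx
  have hnorm : ‖-(η • G)‖ = η * ‖G‖ := by rw [norm_neg, norm_smul, Real.norm_of_nonneg hη]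
  have hdiff : (‖x - η • G‖ - ‖x‖) ^ 2 ≤ (η * ‖G‖) ^ 2 := by
    have habs := abs_norm_sub_norm_le (x - η • G) x
    rw [sub_sub_cancel_left, hnorm] at habs
    exact sq_le_sq' (abs_le.1 habs).1 (abs_le.1 habs).2
  have hquad := (abs_le.1 (abs_inner_apply_le hβ (-(η • G)))).2
  rw [hnorm] at hquad
  rw [← sub_eq_add_neg, hnorm, inner_neg_right, real_inner_smul_right,
    real_inner_self_eq_norm_sq] at hexpand
  have hshift : ρ * ‖x‖ * (η * ‖G‖) ^ 2 ≤ ρ * R * (η * ‖G‖) ^ 2 := by gcongr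
  have hcubic : ρ / 6 * (‖x - η • G‖ - ‖x‖) ^ 2 * (2 * ‖x - η • G‖ + ‖x‖)
      ≤ ρ / 6 * (η * ‖G‖) ^ 2 * (2 * R + R) := by gcongr
  have hsmall : η * ‖G‖ ^ 2 * (η * (β + 2 * ρ * R)) ≤ η * ‖G‖ ^ 2 * (1 / 2) := by
    gcongr
    linarith [mul_nonneg hη hβ₀]
  linarith

lemma mul_norm_sq_apply_add_smul_le (hT : T.IsSymmetric) (hβ : ‖T‖ ≤ β) {t c : ℝ} (ht : 0 ≤ t)
    (htc : t * (β + c) ≤ 1) (hpos : ∀ z, 0 ≤ ⟪z, T z⟫_ℝ + c * ‖z‖ ^ 2) (x : E) :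
    t * ‖T x + c • x‖ ^ 2 ≤ ⟪x, T x⟫_ℝ + c * ‖x‖ ^ 2 := by
  set S : E →L[ℝ] E := T + c • ContinuousLinearMap.id ℝ E
  have hS : S.IsSymmetric := fun y z => by
    simp [S, inner_add_left, inner_add_right, real_inner_smul_left, real_inner_smul_right,
      hT.apply_clm]
  have hinner : ∀ z, ⟪z, S z⟫_ℝ = ⟪z, T z⟫_ℝ + c * ‖z‖ ^ 2 := fun z => by
    simp [S, inner_add_right, real_inner_smul_right]
  have hle : ∀ z, t * ⟪z, S z⟫_ℝ ≤ ‖z‖ ^ 2 := fun z =>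
    calc t * ⟪z, S z⟫_ℝ ≤ t * (β * ‖z‖ ^ 2 + c * ‖z‖ ^ 2) := by
          rw [hinner]
          gcongr
          exact (abs_le.1 (abs_inner_apply_le hβ z)).2
      _ = t * (β + c) * ‖z‖ ^ 2 := by ring
      _ ≤ ‖z‖ ^ 2 := mul_le_of_le_one_left (by positivity) htc
  exact (mul_norm_sq_apply_le_inner hS ht (fun z => hinner z ▸ hpos z) hle x).trans_eq (hinner x)

lemma two_mul_norm_sq_cubicGrad_le (hT : T.IsSymmetric) (hρ : 0 ≤ ρ) (hβ : ‖T‖ ≤ β)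
    (hη : 0 ≤ η) (hηR : 4 * η * (β + ρ * R) ≤ 1) (hs : cubicGrad T b ρ s = 0) (hsR : ‖s‖ ≤ R)
    (hxR : ‖x‖ ≤ R) (hpos : ∀ z, 0 ≤ ⟪z, T z⟫_ℝ + ρ / 2 * (‖x‖ + ‖s‖) * ‖z‖ ^ 2) :
    2 * η * ‖cubicGrad T b ρ x‖ ^ 2 ≤ ⟪x - s, cubicGrad T b ρ x⟫_ℝ := by
  have hβ₀ : 0 ≤ β := (norm_nonneg T).trans hβ
  have hcR : ρ / 2 * (‖x‖ + ‖s‖) ≤ ρ * R :=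
    calc ρ / 2 * (‖x‖ + ‖s‖) ≤ ρ / 2 * (R + R) := by gcongr
      _ = ρ * R := by ring
  have hshift := mul_norm_sq_apply_add_smul_le hT hβ (t := 4 * η) (by positivity)
    (le_trans (by gcongr) hηR) hpos (x - s)
  set q := ρ / 2 * (‖s‖ - ‖x‖) ^ 2 * (‖x‖ + ‖s‖)
  set w := T (x - s) + (ρ / 2 * (‖x‖ + ‖s‖)) • (x - s)
  set u := (ρ / 2 * (‖x‖ - ‖s‖)) • (x + s)
  have hu : ‖u‖ ^ 2 ≤ ρ * R * q :=
    calc ‖u‖ ^ 2 = (ρ / 2 * (‖x‖ - ‖s‖)) ^ 2 * (‖x + s‖ * ‖x + s‖) := by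
          rw [norm_smul, mul_pow, Real.norm_eq_abs, sq_abs, sq ‖x + s‖]
      _ ≤ (ρ / 2 * (‖x‖ - ‖s‖)) ^ 2 * ((‖x‖ + ‖s‖) * (R + R)) := by
          gcongr
          · exact norm_add_le x s
          · exact norm_add_le_of_le hxR hsR
      _ = ρ * R * q := by ring
  calc 2 * η * ‖cubicGrad T b ρ x‖ ^ 2 = 2 * η * ‖w + u‖ ^ 2 := by
        rw [cubicGrad_eq_add_of_cubicGrad_eq_zero hs]
    _ ≤ 2 * η * (2 * (‖w‖ ^ 2 + ‖u‖ ^ 2)) := by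
        gcongr
        exact (pow_le_pow_left₀ (norm_nonneg _) (norm_add_le _ _) 2).trans add_sq_le
    _ = 4 * η * ‖w‖ ^ 2 + 4 * η * ‖u‖ ^ 2 := by ring
    _ ≤ 4 * η * ‖w‖ ^ 2 + 4 * η * (ρ * R * q) := by gcongr
    _ = 4 * η * ‖w‖ ^ 2 + 4 * η * (ρ * R) * q := by ring
    _ ≤ 4 * η * ‖w‖ ^ 2 + q := by
        gcongr
        refine mul_le_of_le_one_left (by positivity) (le_trans ?_ hηR)
        gcongr
        exact le_add_of_nonneg_left hβ₀
    _ ≤ ⟪x - s, cubicGrad T b ρ x⟫_ℝ := by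
        rw [inner_sub_cubicGrad hs]
        gcongr

lemma norm_sq_sub_smul_cubicGrad_sub_le (hT : T.IsSymmetric) (hρ : 0 ≤ ρ) (hβ : ‖T‖ ≤ β)
    (hη : 0 ≤ η) (hηR : 4 * η * (β + ρ * R) ≤ 1) (hs : cubicGrad T b ρ s = 0) (hsR : ‖s‖ ≤ R)
    (hm : ∀ z, m * ‖z‖ ^ 2 ≤ ⟪z, T z⟫_ℝ) (hgap : 0 ≤ ρ * ‖s‖ + m) (hxR : ‖x‖ ≤ R)
    (hx : -((ρ * ‖s‖ + m) / 3) ≤ ρ * ‖x‖ + m) :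
    ‖x - η • cubicGrad T b ρ x - s‖ ^ 2 ≤ (1 - η * (ρ * ‖s‖ + m) / 2) * ‖x - s‖ ^ 2 := by
  set g := ρ * ‖s‖ + m
  have hform : ∀ z, g / 3 * ‖z‖ ^ 2 ≤ ⟪z, T z⟫_ℝ + ρ / 2 * (‖x‖ + ‖s‖) * ‖z‖ ^ 2 := fun z =>
    calc g / 3 * ‖z‖ ^ 2 ≤ (m + ρ / 2 * (‖x‖ + ‖s‖)) * ‖z‖ ^ 2 := by
          gcongr
          linarith
      _ ≤ ⟪z, T z⟫_ℝ + ρ / 2 * (‖x‖ + ‖s‖) * ‖z‖ ^ 2 := by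
          rw [add_mul]
          gcongr
          exact hm z
  have hcoercive := two_mul_norm_sq_cubicGrad_le hT hρ hβ hη hηR hs hsR hxR
    fun z => (by positivity : 0 ≤ g / 3 * ‖z‖ ^ 2).trans (hform z)
  have hmonotone : g / 3 * ‖x - s‖ ^ 2 ≤ ⟪x - s, cubicGrad T b ρ x⟫_ℝ := by
    rw [inner_sub_cubicGrad hs]
    exact (hform _).trans (le_add_of_nonneg_right (by positivity))
  rw [sub_right_comm, norm_sub_smul_sq]
  linarith [mul_le_mul_of_nonneg_left hcoercive hη, mul_le_mul_of_nonneg_left hmonotone hη]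

/-! ### Bounds by the two radii -/

/-- The Cauchy radius `R_c`: the model decreases along the ray spanned by `-b` up to this radius. -/
noncomputable def lineRadius (T : E →L[ℝ] E) (b : E) (ρ : ℝ) : ℝ :=
  -⟪b, T b⟫_ℝ / (2 * ρ * ‖b‖ ^ 2) + √((⟪b, T b⟫_ℝ / (2 * ρ * ‖b‖ ^ 2)) ^ 2 + ‖b‖ / ρ)

lemma lineRadius_eq_largerRoot (T : E →L[ℝ] E) (b : E) (ρ : ℝ) :
    lineRadius T b ρ = largerRoot (-⟪b, T b⟫_ℝ / (2 * ρ * ‖b‖ ^ 2)) (‖b‖ / ρ) := by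
  rw [lineRadius, largerRoot, neg_div, neg_sq]

lemma norm_le_trapRadius (hρ : 0 < ρ) (hβ : ‖T‖ ≤ β) (hx : ⟪x, cubicGrad T b ρ x⟫_ℝ ≤ 0) :
    ‖x‖ ≤ trapRadius β ρ b := by
  rw [trapRadius_eq_largerRoot, le_largerRoot_iff (by positivity) (norm_nonneg x)]
  rcases (norm_nonneg x).eq_or_lt with hzero | hpos
  · rw [← hzero]
    simpa only [zero_pow two_ne_zero, mul_zero, zero_add] using div_nonneg (norm_nonneg b) hρ.le
  · rw [inner_cubicGrad, real_inner_self_eq_norm_sq] at hx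
    have hcubic : ‖x‖ * (ρ * ‖x‖ ^ 2) ≤ ‖x‖ * (β * ‖x‖ + ‖b‖) := by
      linarith [(abs_le.1 (abs_inner_apply_le hβ x)).1, (abs_le.1 (abs_real_inner_le_norm x b)).1]
    have hquad := le_of_mul_le_mul_left hcubic hpos
    calc ‖x‖ ^ 2 ≤ (β * ‖x‖ + ‖b‖) / ρ := by
          rw [le_div_iff₀ hρ]
          linarith
      _ = 2 * (β / (2 * ρ)) * ‖x‖ + ‖b‖ / ρ := by field_simp

lemma norm_sub_smul_cubicGrad_le (hρ : 0 < ρ) (hβ : ‖T‖ ≤ β) (hη : 0 ≤ η)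
    (hηR : 4 * η * (β + ρ * trapRadius β ρ b) ≤ 1) (hx : ‖x‖ ≤ trapRadius β ρ b) :
    ‖x - η • cubicGrad T b ρ x‖ ≤ 3 / 2 * trapRadius β ρ b := by
  have hquad := mul_trapRadius_sq hρ β b
  set R := trapRadius β ρ b
  have hβ₀ : 0 ≤ β := (norm_nonneg T).trans hβ
  have hR₀ : 0 ≤ R := (norm_nonneg x).trans hx
  calc ‖x - η • cubicGrad T b ρ x‖ ≤ ‖x‖ + η * ‖cubicGrad T b ρ x‖ := by
        simpa only [norm_smul, Real.norm_of_nonneg hη] using norm_sub_le x (η • cubicGrad T b ρ x)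
    _ ≤ R + η * (β * R + ‖b‖ + ρ * R ^ 2) := by
        gcongr
        exact (norm_cubicGrad_le hρ.le hβ x).trans (by gcongr)
    _ = R + 2 * η * (ρ * R) * R := by linear_combination (-η) * hquad
    _ ≤ 3 / 2 * R := by
        have hscaled := mul_le_mul_of_nonneg_right hηR hR₀
        linarith [mul_nonneg (mul_nonneg hη hβ₀) hR₀]

lemma inner_cubicGrad_nonpos_of_le_lineRadius (hρ : 0 < ρ) (hb : b ≠ 0) {r : ℝ} (hr₀ : 0 ≤ r)
    (hr : r ≤ lineRadius T b ρ) :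
    ⟪-(r / ‖b‖) • b, cubicGrad T b ρ (-(r / ‖b‖) • b)⟫_ℝ ≤ 0 := by
  have hb₀ : 0 < ‖b‖ := norm_pos_iff.2 hb
  rw [lineRadius_eq_largerRoot, le_largerRoot_iff (by positivity) hr₀] at hr
  have hnorm : ‖-(r / ‖b‖) • b‖ = r := by
    rw [norm_smul, norm_neg, Real.norm_of_nonneg (by positivity), div_mul_cancel₀ _ hb₀.ne']
  calc ⟪-(r / ‖b‖) • b, cubicGrad T b ρ (-(r / ‖b‖) • b)⟫_ℝ
      = r * ρ * (r ^ 2 - (2 * (-⟪b, T b⟫_ℝ / (2 * ρ * ‖b‖ ^ 2)) * r + ‖b‖ / ρ)) := by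
        rw [inner_cubicGrad, map_smul, real_inner_self_eq_norm_sq, hnorm, real_inner_smul_left,
          real_inner_smul_right, real_inner_smul_left, real_inner_self_eq_norm_sq]
        field_simp
        ring
    _ ≤ 0 := mul_nonpos_of_nonneg_of_nonpos (by positivity) (sub_nonpos.2 hr)

end Model

/-! ### Descent coordinates in an eigenbasis -/

section Eigenbasis

variable {E : Type*} [NormedAddCommGroup E] [InnerProductSpace ℝ E] {ι : Type*} [Fintype ι]
  {T : E →L[ℝ] E} {e : OrthonormalBasis ι ℝ E} {lam y : ι → ℝ} {b x : E} {ρ η : ℝ}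

lemma inner_eq_sum (e : OrthonormalBasis ι ℝ E) (x y : E) :
    ⟪x, y⟫_ℝ = ∑ i, ⟪e i, x⟫_ℝ * ⟪e i, y⟫_ℝ := by
  simpa only [real_inner_comm x] using (e.sum_inner_mul_inner x y).symm

lemma mul_norm_sq_le_inner_apply (hT : T.IsSymmetric) (he : ∀ i, T (e i) = lam i • e i) {m : ℝ}
    (hm : ∀ i, m ≤ lam i) (x : E) : m * ‖x‖ ^ 2 ≤ ⟪x, T x⟫_ℝ := by
  rw [← real_inner_self_eq_norm_sq, inner_eq_sum e, inner_eq_sum e, Finset.mul_sum]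
  refine Finset.sum_le_sum fun i _ => ?_
  rw [inner_apply_eigenvector hT (he i), mul_left_comm ⟪e i, x⟫_ℝ]
  exact mul_le_mul_of_nonneg_right (hm i) (mul_self_nonneg _)

lemma inner_basis_cubicGrad (hT : T.IsSymmetric) (he : ∀ i, T (e i) = lam i • e i)
    (hx : ∀ i, ⟪e i, x⟫_ℝ = -(⟪e i, b⟫_ℝ * y i)) (i : ι) :
    ⟪e i, cubicGrad T b ρ x⟫_ℝ = ⟪e i, b⟫_ℝ * slack (fun i => lam i + ρ * ‖x‖) y i := by
  rw [inner_cubicGrad, inner_apply_eigenvector hT (he i), hx, slack]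
  ring

lemma inner_self_cubicGrad_eq_sum (hT : T.IsSymmetric) (he : ∀ i, T (e i) = lam i • e i)
    (hx : ∀ i, ⟪e i, x⟫_ℝ = -(⟪e i, b⟫_ℝ * y i)) :
    ⟪x, cubicGrad T b ρ x⟫_ℝ =
      -∑ i, ⟪e i, b⟫_ℝ ^ 2 * (y i * slack (fun i => lam i + ρ * ‖x‖) y i) := by
  rw [inner_eq_sum e, ← Finset.sum_neg_distrib]
  refine Finset.sum_congr rfl fun i _ => ?_
  rw [inner_basis_cubicGrad hT he hx, hx i]
  ring

lemma inner_basis_sub_smul_cubicGrad (hT : T.IsSymmetric) (he : ∀ i, T (e i) = lam i • e i)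
    (hx : ∀ i, ⟪e i, x⟫_ℝ = -(⟪e i, b⟫_ℝ * y i)) (η : ℝ) (i : ι) :
    ⟪e i, x - η • cubicGrad T b ρ x⟫_ℝ =
      -(⟪e i, b⟫_ℝ * coordStep η (fun i => lam i + ρ * ‖x‖) y i) := by
  rw [inner_sub_right, real_inner_smul_right, inner_basis_cubicGrad hT he hx, hx, coordStep]
  ring

lemma norm_sq_eq_sum_sq_mul_sq (hx : ∀ i, ⟪e i, x⟫_ℝ = -(⟪e i, b⟫_ℝ * y i)) :
    ‖x‖ ^ 2 = ∑ i, ⟪e i, b⟫_ℝ ^ 2 * y i ^ 2 := by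
  rw [← real_inner_self_eq_norm_sq, inner_eq_sum e]
  exact Finset.sum_congr rfl fun i _ => by rw [hx i]; ring

/-- The coordinates `y` describe `x` as a point that gradient descent from the ray `-ℝ₊ b` can
reach: in the eigenbasis `e`, with eigenvalues `lam`, each coordinate of `x` is a nonpositive
multiple `-y i` of that of `b`, and the slacks of these multiples are ordered. -/
structure IsDescentCoord (e : OrthonormalBasis ι ℝ E) (lam : ι → ℝ) (b : E) (ρ : ℝ) (x : E)
    (y : ι → ℝ) : Prop where
  inner_eq : ∀ i, ⟪e i, x⟫_ℝ = -(⟪e i, b⟫_ℝ * y i)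
  nonneg : ∀ i, 0 ≤ y i
  ordered : SlackOrdered (fun i => lam i + ρ * ‖x‖) y

lemma isDescentCoord_neg_smul (e : OrthonormalBasis ι ℝ E) (lam : ι → ℝ) (b : E) (ρ : ℝ) {c : ℝ}
    (hc : 0 ≤ c) : IsDescentCoord e lam b ρ (-c • b) fun _ => c where
  inner_eq i := by rw [real_inner_smul_right, neg_mul, mul_comm]
  nonneg _ := hc
  ordered := slackOrdered_const _ hc

namespace IsDescentCoord

lemma inner_nonpos (h : IsDescentCoord e lam b ρ x y) : ⟪b, x⟫_ℝ ≤ 0 := by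
  rw [inner_eq_sum e]
  refine Finset.sum_nonpos fun i _ => ?_
  rw [h.inner_eq, mul_neg, ← mul_assoc]
  exact neg_nonpos.2 (mul_nonneg (mul_self_nonneg _) (h.nonneg i))

lemma sub_smul_cubicGrad (hT : T.IsSymmetric) (he : ∀ i, T (e i) = lam i • e i) (hρ : 0 ≤ ρ)
    (hη : 0 < η) (hlam : ∀ i, η * (lam i + ρ * ‖x‖) ≤ 1) (h : IsDescentCoord e lam b ρ x y)
    (hx : ⟪x, cubicGrad T b ρ x⟫_ℝ ≤ 0) :
    IsDescentCoord e lam b ρ (x - η • cubicGrad T b ρ x)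
      (coordStep η (fun i => lam i + ρ * ‖x‖) y) where
  inner_eq := inner_basis_sub_smul_cubicGrad hT he h.inner_eq η
  nonneg i := (coordStep_pos hη (h.nonneg i) (hlam i)).le
  ordered := by
    have hgrow : 0 ≤ ρ * (‖x - η • cubicGrad T b ρ x‖ - ‖x‖) :=
      mul_nonneg hρ (sub_nonneg.2 (norm_le_norm_sub_smul hη.le hx))
    convert h.ordered.coordStep hη hgrow h.nonneg hlam using 2
    ring

lemma inner_cubicGrad_sub_smul_nonpos (hT : T.IsSymmetric) (he : ∀ i, T (e i) = lam i • e i)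
    (hρ : 0 ≤ ρ) (hη : 0 < η)
    (hlam : ∀ i, η * (lam i + ρ * ‖x‖ + 2 * ρ * ‖x - η • cubicGrad T b ρ x‖) ≤ 1)
    (h : IsDescentCoord e lam b ρ x y) (hx : ⟪x, cubicGrad T b ρ x⟫_ℝ ≤ 0) :
    ⟪x - η • cubicGrad T b ρ x, cubicGrad T b ρ (x - η • cubicGrad T b ρ x)⟫_ℝ ≤ 0 := by
  have hx' := inner_basis_sub_smul_cubicGrad (ρ := ρ) hT he h.inner_eq η
  set x' := x - η • cubicGrad T b ρ x
  obtain ⟨κ, hκ₀, hκ, hκ_eq⟩ := exists_mul_sub_mul_sq_eq (norm_nonneg x) (norm_nonneg x')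
  have hshift : (fun i => lam i + ρ * ‖x'‖) =
      fun i => lam i + ρ * ‖x‖ + ρ * (‖x'‖ - ‖x‖) := by
    ext i
    ring
  rw [inner_self_cubicGrad_eq_sum hT he h.inner_eq, neg_nonpos] at hx
  rw [inner_self_cubicGrad_eq_sum hT he hx', neg_nonpos, hshift]
  refine h.ordered.sum_mul_slack_coordStep_nonneg (κ := ρ * κ) hη (mul_nonneg hρ hκ₀)
    (fun i => sq_nonneg _) h.nonneg (fun i => le_trans ?_ (hlam i)) ?_ hx
  · rw [mul_assoc 2 ρ]
    gcongr
  · rw [← norm_sq_eq_sum_sq_mul_sq hx', ← norm_sq_eq_sum_sq_mul_sq h.inner_eq, mul_assoc, hκ_eq,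
      mul_assoc]

end IsDescentCoord

end Eigenbasis

/-! ### Compression to a subspace -/

section Compression

variable {E : Type*} [NormedAddCommGroup E] [InnerProductSpace ℝ E] {V : Submodule ℝ E}
  [V.HasOrthogonalProjection] {T : E →L[ℝ] E}

/-- The compression of `T` to `V`. It makes the spectral theorem available on a finite-dimensional
subspace that contains a given initial segment of a gradient run. -/
noncomputable def compression (V : Submodule ℝ E) [V.HasOrthogonalProjection] (T : E →L[ℝ] E) :
    V →L[ℝ] V :=
  V.orthogonalProjectionOnto ∘L T ∘L V.subtypeL

lemma inner_compression (T : E →L[ℝ] E) (x y : V) :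
    ⟪x, compression V T y⟫_ℝ = ⟪(x : E), T y⟫_ℝ :=
  Submodule.inner_orthogonalProjectionOnto_eq_of_mem_left x (T y)

lemma isSymmetric_compression (hT : T.IsSymmetric) : (compression V T).IsSymmetric := fun x y => by
  change ⟪compression V T x, y⟫_ℝ = ⟪x, compression V T y⟫_ℝ
  rw [real_inner_comm, inner_compression, inner_compression, ← hT.apply_clm, real_inner_comm]

lemma norm_compression_le (V : Submodule ℝ E) [V.HasOrthogonalProjection] (T : E →L[ℝ] E) :
    ‖compression V T‖ ≤ ‖T‖ :=
  ContinuousLinearMap.opNorm_le_bound _ (norm_nonneg T) fun x =>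
    (V.norm_orthogonalProjectionOnto_apply_le (T x)).trans (T.le_opNorm x)

lemma coe_compression_of_mem {x : V} (hx : T x ∈ V) : (compression V T x : E) = T x :=
  Submodule.starProjection_eq_self_iff.2 hx

lemma coe_cubicGrad_compression (b : V) (ρ : ℝ) {x : V} (hx : T x ∈ V) :
    ((cubicGrad (compression V T) b ρ x : V) : E) = cubicGrad T b ρ x := by
  simp only [cubicGrad, Submodule.coe_add, Submodule.coe_smul, Submodule.coe_norm,
    coe_compression_of_mem hx]

lemma inner_cubicGrad_compression (T : E →L[ℝ] E) (b x : V) (ρ : ℝ) :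
    ⟪x, cubicGrad (compression V T) b ρ x⟫_ℝ = ⟪(x : E), cubicGrad T b ρ x⟫_ℝ := by
  rw [inner_cubicGrad, inner_cubicGrad, inner_compression, Submodule.coe_inner, Submodule.coe_inner,
    Submodule.coe_norm]

end Compression

/-! ### Scalar estimates for the two stages -/

section Scalar

lemma one_add_mul_pow_le {y : ℕ → ℝ} {η δ : ℝ} (hη : 0 ≤ η) (hδ : 0 ≤ δ) {t : ℕ} (hy₀ : 0 ≤ y 0)
    (hy : ∀ k < t, 0 ≤ y k → (1 + η * δ) * y k + η ≤ y (k + 1)) :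
    (1 + η * δ) ^ t ≤ 1 + δ * y t := by
  suffices hgrowth : ∀ k ≤ t, 0 ≤ y k ∧ (1 + η * δ) ^ k ≤ 1 + δ * y k from (hgrowth t le_rfl).2
  intro k hk
  induction k with
  | zero => exact ⟨hy₀, by simpa only [pow_zero] using le_add_of_nonneg_right (by positivity)⟩
  | succ k ih =>
    obtain ⟨hnonneg, hpow⟩ := ih (by omega)
    have hstep := hy k (by omega) hnonneg
    refine ⟨le_trans (by positivity) hstep, ?_⟩
    calc (1 + η * δ) ^ (k + 1) ≤ (1 + η * δ) * (1 + δ * y k) := by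
          rw [pow_succ']
          gcongr
      _ = 1 + δ * ((1 + η * δ) * y k + η) := by ring
      _ ≤ 1 + δ * y (k + 1) := by gcongr

lemma half_le_log_one_add {u : ℝ} (hu₀ : 0 ≤ u) (hu : u ≤ 1) : u / 2 ≤ Real.log (1 + u) :=
  calc u / 2 ≤ 2 * u / (u + 2) := by
        rw [div_le_div_iff₀ two_pos (by positivity)]
        linarith [mul_le_mul_of_nonneg_left hu hu₀]
    _ ≤ Real.log (1 + u) := Real.le_log_one_add_of_nonneg hu₀

lemma one_sub_pow_le_inv {u q : ℝ} {k : ℕ} (hu : u ≤ 1) (hq : 0 < q)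
    (hk : Real.log q ≤ k * u) : (1 - u) ^ k ≤ q⁻¹ :=
  calc (1 - u) ^ k ≤ Real.exp (-u) ^ k :=
        pow_le_pow_left₀ (sub_nonneg.2 hu) (Real.one_sub_le_exp_neg u) k
    _ = Real.exp (-(k * u)) := by rw [← Real.exp_nat_mul, mul_neg]
    _ ≤ Real.exp (-Real.log q) := Real.exp_le_exp.2 (neg_le_neg hk)
    _ = q⁻¹ := by rw [Real.exp_neg, Real.exp_log hq]

lemma exists_eq_add_of_add_le_mul {p q c : ℝ} {t : ℕ} (hp : 0 ≤ p) (hc : 0 < c) (hq : c ≤ q)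
    (ht : p + q ≤ t * c) : ∃ t₀ k : ℕ, t = t₀ + k ∧ p ≤ t₀ * c ∧ q - c ≤ k * c := by
  have hlt : (⌈p / c⌉₊ : ℝ) * c < p + c := by
    rw [← lt_div_iff₀ hc, add_div, div_self hc.ne']
    exact Nat.ceil_lt_add_one (by positivity)
  have hle : ⌈p / c⌉₊ ≤ t := by
    have hmul : (⌈p / c⌉₊ : ℝ) * c ≤ t * c := by linarith
    exact_mod_cast le_of_mul_le_mul_right hmul hc
  obtain ⟨k, rfl⟩ := Nat.exists_eq_add_of_le hle
  refine ⟨_, k, rfl, (div_le_iff₀ hc).1 (Nat.le_ceil _), ?_⟩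
  push_cast at ht
  linarith

lemma le_mul_of_div_mul_inv_le {τ η g t : ℝ} (hη : 0 < η) (hg : 0 < g) (h : τ / η * g⁻¹ ≤ t) :
    τ ≤ t * (η * g) := by
  rwa [← div_eq_mul_inv, div_div, div_le_iff₀ (mul_pos hη hg)] at h

lemma tauGrow_nonneg {ρ : ℝ} (hρ : 0 ≤ ρ) (m b₁ : ℝ) : 0 ≤ tauGrow m ρ b₁ :=
  mul_nonneg (by norm_num) (Real.log_nonneg (le_add_of_nonneg_right (by positivity)))

lemma four_le_tauConverge {β ρ n ε : ℝ} (hε : 0 < ε) (hlarge : 2 * ε < (β + 2 * ρ * n) * n ^ 2) :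
    4 ≤ tauConverge β ρ n ε := by
  have hlog : Real.log 2 ≤ Real.log ((β + 2 * ρ * n) * n ^ 2 / ε) :=
    Real.log_le_log two_pos ((le_div_iff₀ hε).2 hlarge.le)
  unfold tauConverge
  linarith [Real.log_two_gt_d9]

lemma four_mul_mul_mul_lt_sq {ρ n m δ : ℝ} (hδ : 0 < δ) (h : ρ * n + m < -δ) :
    4 * ρ * (δ * n) < m ^ 2 := by
  linarith [mul_lt_mul_of_pos_left h hδ, sq_nonneg (m + 2 * δ)]

end Scalar

/-! ### Gradient runs -/

section Run

variable {E : Type*} [NormedAddCommGroup E] [InnerProductSpace ℝ E] {T : E →L[ℝ] E}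
  {b s v : E} {ρ β η m : ℝ} {x : ℕ → E}

/-- `x` is a run of gradient descent on `cubicModel T b ρ` with step size `η`, started on the ray
spanned by `-b` at a point where the model does not increase radially. The step size is small
relative to the bound `β` on the norm of `T`. -/
structure GradientRun (T : E →L[ℝ] E) (b : E) (ρ β η : ℝ) (x : ℕ → E) : Prop where
  symm : T.IsSymmetric
  opNorm_le : ‖T‖ ≤ β
  ρ_pos : 0 < ρ
  η_pos : 0 < η
  η_le : 4 * η * (β + ρ * trapRadius β ρ b) ≤ 1
  exists_start : ∃ c : ℝ, 0 ≤ c ∧ x 0 = -c • b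
  start_nonpos : ⟪x 0, cubicGrad T b ρ (x 0)⟫_ℝ ≤ 0
  step : ∀ t, x (t + 1) = x t - η • cubicGrad T b ρ (x t)

namespace GradientRun

lemma compression {V : Submodule ℝ E} [V.HasOrthogonalProjection] {x' : ℕ → V}
    (h : GradientRun T b ρ β η x) (hb : b ∈ V) (hx'₀ : (x' 0 : E) = x 0)
    (hx' : ∀ t, x' (t + 1) = x' t - η • cubicGrad (compression V T) ⟨b, hb⟩ ρ (x' t)) :
    GradientRun (compression V T) ⟨b, hb⟩ ρ β η x' where
  symm := isSymmetric_compression h.symm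
  opNorm_le := (norm_compression_le V T).trans h.opNorm_le
  ρ_pos := h.ρ_pos
  η_pos := h.η_pos
  η_le := h.η_le
  exists_start := by
    obtain ⟨c, hc, hx₀⟩ := h.exists_start
    exact ⟨c, hc, Subtype.ext (hx'₀.trans hx₀)⟩
  start_nonpos := by
    rw [inner_cubicGrad_compression, hx'₀]
    exact h.start_nonpos
  step := hx'

/-- Up to time `t` the run lives in the span of `b` and the vectors `T (x k)`, `k < t`. -/
lemma exists_finiteDimensional (h : GradientRun T b ρ β η x) (t : ℕ) :
    ∃ (V : Submodule ℝ E) (_ : FiniteDimensional ℝ V) (b' : V) (x' : ℕ → V),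
      GradientRun (CubicGD.compression V T) b' ρ β η x' ∧ (b' : E) = b ∧ (x' t : E) = x t := by
  set V := Submodule.span ℝ (insert b ((fun k => T (x k)) '' Set.Iio t))
  have hfin : FiniteDimensional ℝ V :=
    FiniteDimensional.span_of_finite ℝ (((Set.finite_Iio t).image _).insert b)
  have hb : b ∈ V := Submodule.subset_span (Set.mem_insert ..)
  have hTx : ∀ k < t, T (x k) ∈ V := fun k hk =>
    Submodule.subset_span (Set.mem_insert_of_mem _ ⟨k, hk, rfl⟩)
  obtain ⟨c, -, hx₀⟩ := h.exists_start
  let x' : ℕ → V := fun k =>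
    (fun z => z - η • cubicGrad (CubicGD.compression V T) ⟨b, hb⟩ ρ z)^[k] (-c • ⟨b, hb⟩)
  have hx' : ∀ k, x' (k + 1) = x' k - η • cubicGrad (CubicGD.compression V T) ⟨b, hb⟩ ρ (x' k) :=
    fun k => Function.iterate_succ_apply' ..
  have hcoe : ∀ k ≤ t, (x' k : E) = x k := fun k hk => by
    induction k with
    | zero => exact hx₀.symm
    | succ k ih =>
      have hxk := ih (by omega)
      have hTxk : T (x' k) ∈ V := by
        rw [hxk]
        exact hTx k hk
      rw [hx', h.step, Submodule.coe_sub, Submodule.coe_smul, coe_cubicGrad_compression _ _ hTxk,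
        hxk]
  exact ⟨V, hfin, ⟨b, hb⟩, x', h.compression hb hx₀.symm hx', rfl, hcoe t le_rfl⟩

lemma inner_cubicGrad_nonpos_and_inner_nonpos_of_finiteDimensional [FiniteDimensional ℝ E]
    (h : GradientRun T b ρ β η x) (t : ℕ) :
    ⟪x t, cubicGrad T b ρ (x t)⟫_ℝ ≤ 0 ∧ ⟪b, x t⟫_ℝ ≤ 0 := by
  set e := h.symm.eigenvectorBasis rfl
  set lam := h.symm.eigenvalues rfl
  have he : ∀ i, T (e i) = lam i • e i := h.symm.apply_eigenvectorBasis rfl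
  have hlam : ∀ i, lam i ≤ β := fun i =>
    eigenvalue_le_of_opNorm_le h.opNorm_le (e.orthonormal.norm_eq_one i) (he i)
  suffices hdesc : ⟪x t, cubicGrad T b ρ (x t)⟫_ℝ ≤ 0 ∧ ∃ y, IsDescentCoord e lam b ρ (x t) y from
    ⟨hdesc.1, hdesc.2.elim fun _ hy => hy.inner_nonpos⟩
  have hρ := h.ρ_pos
  have hη := h.η_pos
  induction t with
  | zero =>
    obtain ⟨c, hc, hx₀⟩ := h.exists_start
    exact ⟨h.start_nonpos, _, hx₀ ▸ isDescentCoord_neg_smul e lam b ρ hc⟩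
  | succ t ih =>
    obtain ⟨hnonpos, y, hy⟩ := ih
    have hR := norm_le_trapRadius hρ h.opNorm_le hnonpos
    have hR' := norm_sub_smul_cubicGrad_le hρ h.opNorm_le hη.le h.η_le hR
    have hβ : 0 ≤ β := (norm_nonneg T).trans h.opNorm_le
    have hsmall : ∀ i, η * (lam i + ρ * ‖x t‖ + 2 * ρ * ‖x t - η • cubicGrad T b ρ (x t)‖) ≤ 1 :=
      fun i =>
        calc _ ≤ η * (β + ρ * trapRadius β ρ b + 2 * ρ * (3 / 2 * trapRadius β ρ b)) := by
              gcongr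
              exact hlam i
          _ = η * β + 4 * η * (ρ * trapRadius β ρ b) := by ring
          _ ≤ 1 := by linarith [h.η_le, mul_nonneg hη.le hβ]
    rw [h.step]
    exact ⟨hy.inner_cubicGrad_sub_smul_nonpos h.symm he hρ.le hη hsmall hnonpos, _,
      hy.sub_smul_cubicGrad h.symm he hρ.le hη (fun i => le_trans
        (mul_le_mul_of_nonneg_left (le_add_of_nonneg_right (by positivity)) hη.le) (hsmall i))
        hnonpos⟩

lemma inner_cubicGrad_nonpos (h : GradientRun T b ρ β η x) (t : ℕ) :
    ⟪x t, cubicGrad T b ρ (x t)⟫_ℝ ≤ 0 := by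
  obtain ⟨V, _, b', x', h', rfl, hxt⟩ := h.exists_finiteDimensional t
  rw [← hxt, ← inner_cubicGrad_compression]
  exact (h'.inner_cubicGrad_nonpos_and_inner_nonpos_of_finiteDimensional t).1

lemma inner_nonpos (h : GradientRun T b ρ β η x) (t : ℕ) : ⟪b, x t⟫_ℝ ≤ 0 := by
  obtain ⟨V, _, b', x', h', rfl, hxt⟩ := h.exists_finiteDimensional t
  rw [← hxt, ← Submodule.coe_inner]
  exact (h'.inner_cubicGrad_nonpos_and_inner_nonpos_of_finiteDimensional t).2

lemma norm_le_trapRadius (h : GradientRun T b ρ β η x) (t : ℕ) : ‖x t‖ ≤ trapRadius β ρ b :=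
  CubicGD.norm_le_trapRadius h.ρ_pos h.opNorm_le (h.inner_cubicGrad_nonpos t)

lemma norm_monotone (h : GradientRun T b ρ β η x) : Monotone fun t => ‖x t‖ :=
  monotone_nat_of_le_succ fun t => by
    rw [h.step]
    exact norm_le_norm_sub_smul h.η_pos.le (h.inner_cubicGrad_nonpos t)

lemma norm_criticalPoint_le (h : GradientRun T b ρ β η x) (hs : cubicGrad T b ρ s = 0) :
    ‖s‖ ≤ trapRadius β ρ b :=
  CubicGD.norm_le_trapRadius h.ρ_pos h.opNorm_le (by rw [hs, inner_zero_right])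

/-! ### Growth along an eigenvector -/

lemma inner_succ (h : GradientRun T b ρ β η x) (hTv : T v = m • v) (t : ℕ) :
    ⟪v, x (t + 1)⟫_ℝ = (1 - η * (ρ * ‖x t‖ + m)) * ⟪v, x t⟫_ℝ - η * ⟪v, b⟫_ℝ := by
  rw [h.step, inner_sub_right, real_inner_smul_right, inner_cubicGrad,
    inner_apply_eigenvector h.symm hTv]
  ring

lemma one_add_mul_pow_le_of_shifted_le (h : GradientRun T b ρ β η x) (hTv : T v = m • v)
    (hb : ⟪v, b⟫_ℝ ≠ 0) {δ : ℝ} (hδ : 0 ≤ δ) {t : ℕ} (ht : ρ * ‖x t‖ + m ≤ -δ) :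
    (1 + η * δ) ^ t ≤ 1 + δ * (-⟪v, x t⟫_ℝ / ⟪v, b⟫_ℝ) := by
  refine one_add_mul_pow_le (y := fun k => -⟪v, x k⟫_ℝ / ⟪v, b⟫_ℝ) h.η_pos.le hδ ?_
    fun k hk hnonneg => ?_
  · obtain ⟨c, hc, hx₀⟩ := h.exists_start
    rwa [hx₀, real_inner_smul_right, neg_mul, neg_neg, mul_div_cancel_right₀ _ hb]
  · have hstep : -⟪v, x (k + 1)⟫_ℝ / ⟪v, b⟫_ℝ =
        (1 - η * (ρ * ‖x k‖ + m)) * (-⟪v, x k⟫_ℝ / ⟪v, b⟫_ℝ) + η := by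
      rw [h.inner_succ hTv]
      field_simp
      ring
    have hshift : ρ * ‖x k‖ + m ≤ -δ :=
      le_trans (by gcongr; exacts [h.ρ_pos.le, h.norm_monotone hk.le]) ht
    have hfactor := mul_le_mul_of_nonneg_left hshift h.η_pos.le
    rw [hstep]
    gcongr
    linarith

lemma neg_le_shifted (h : GradientRun T b ρ β η x) (hv : ‖v‖ = 1) (hTv : T v = m • v)
    (hb : ⟪v, b⟫_ℝ ≠ 0) {g : ℝ} (hg : 0 < g) (hηg : η * g ≤ 1) {t : ℕ}
    (ht : tauGrow m ρ ⟪v, b⟫_ℝ ≤ t * (η * g)) : -(g / 3) ≤ ρ * ‖x t‖ + m := by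
  by_contra! hlt
  have hρ := h.ρ_pos
  have hη := h.η_pos
  have hm : max (-m) 0 = -m := max_eq_left (by linarith [mul_nonneg hρ.le (norm_nonneg (x t))])
  have hcoord : -⟪v, x t⟫_ℝ / ⟪v, b⟫_ℝ ≤ ‖x t‖ / |⟪v, b⟫_ℝ| :=
    calc -⟪v, x t⟫_ℝ / ⟪v, b⟫_ℝ ≤ |⟪v, x t⟫_ℝ| / |⟪v, b⟫_ℝ| := by
          rw [← abs_neg, ← abs_div]
          exact le_abs_self _
      _ ≤ ‖x t‖ / |⟪v, b⟫_ℝ| := by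
          gcongr
          simpa only [hv, one_mul] using abs_real_inner_le_norm v (x t)
  have hpow : (1 + η * (g / 3)) ^ t < 1 + max (-m) 0 ^ 2 / (4 * ρ * |⟪v, b⟫_ℝ|) :=
    calc (1 + η * (g / 3)) ^ t ≤ 1 + g / 3 * (‖x t‖ / |⟪v, b⟫_ℝ|) :=
          (h.one_add_mul_pow_le_of_shifted_le hTv hb (by positivity) hlt.le).trans (by gcongr)
      _ = 1 + 4 * ρ * (g / 3 * ‖x t‖) / (4 * ρ * |⟪v, b⟫_ℝ|) := by field_simp
      _ < 1 + max (-m) 0 ^ 2 / (4 * ρ * |⟪v, b⟫_ℝ|) := by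
          rw [hm, neg_sq]
          gcongr
          exact four_mul_mul_mul_lt_sq (by positivity) hlt
  have hlog := Real.log_lt_log (by positivity) hpow
  rw [Real.log_pow] at hlog
  have hrate := mul_le_mul_of_nonneg_left
    (half_le_log_one_add (u := η * (g / 3)) (by positivity) (by linarith)) (Nat.cast_nonneg t)
  unfold tauGrow at ht
  linarith

lemma exists_growth_stage (h : GradientRun T b ρ β η x) (hv : ‖v‖ = 1) (hTv : T v = m • v)
    (hb : ⟪v, b⟫_ℝ ≠ 0) {g q : ℝ} (hg : 0 < g) (hηg : η * g ≤ 1) (hq : 1 ≤ q) {t : ℕ}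
    (ht : tauGrow m ρ ⟪v, b⟫_ℝ + q ≤ t * (η * g)) :
    ∃ t₀ k : ℕ, t = t₀ + k ∧ -(g / 3) ≤ ρ * ‖x t₀‖ + m ∧ q - 1 ≤ k * (η * g) := by
  obtain ⟨t₀, k, ht_eq, ht₀, hk⟩ := exists_eq_add_of_add_le_mul (tauGrow_nonneg h.ρ_pos.le m _)
    (mul_pos h.η_pos hg) (hηg.trans hq) ht
  exact ⟨t₀, k, ht_eq, h.neg_le_shifted hv hTv hb hg hηg ht₀, by linarith⟩

/-! ### Linear convergence -/

lemma η_mul_gap_le (h : GradientRun T b ρ β η x) (hs : cubicGrad T b ρ s = 0) (hv : ‖v‖ = 1)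
    (hTv : T v = m • v) : η * (ρ * ‖s‖ + m) ≤ 1 / 4 := by
  have hle : η * (ρ * ‖s‖ + m) ≤ η * (ρ * trapRadius β ρ b + β) := by
    gcongr
    · exact h.η_pos.le
    · exact h.ρ_pos.le
    · exact h.norm_criticalPoint_le hs
    · exact eigenvalue_le_of_opNorm_le h.opNorm_le hv hTv
  linarith [h.η_le]

lemma norm_sq_sub_le_pow (h : GradientRun T b ρ β η x) (hs : cubicGrad T b ρ s = 0)
    (hm : ∀ z, m * ‖z‖ ^ 2 ≤ ⟪z, T z⟫_ℝ) (hgap : 0 ≤ ρ * ‖s‖ + m)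
    (hηg : η * (ρ * ‖s‖ + m) ≤ 1) {t₀ : ℕ} (ht₀ : -((ρ * ‖s‖ + m) / 3) ≤ ρ * ‖x t₀‖ + m) (k : ℕ) :
    ‖x (t₀ + k) - s‖ ^ 2 ≤ (1 - η * (ρ * ‖s‖ + m) / 2) ^ k * ‖x t₀ - s‖ ^ 2 := by
  induction k with
  | zero => rw [pow_zero, one_mul, add_zero]
  | succ k ih =>
    have hgrow : ρ * ‖x t₀‖ ≤ ρ * ‖x (t₀ + k)‖ :=
      mul_le_mul_of_nonneg_left (h.norm_monotone (Nat.le_add_right t₀ k)) h.ρ_pos.le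
    have hcontract := norm_sq_sub_smul_cubicGrad_sub_le h.symm h.ρ_pos.le h.opNorm_le h.η_pos.le
      h.η_le hs (h.norm_criticalPoint_le hs) hm hgap (h.norm_le_trapRadius (t₀ + k)) (by linarith)
    rw [← h.step] at hcontract
    refine hcontract.trans ?_
    rw [pow_succ' (1 - _), mul_assoc]
    exact mul_le_mul_of_nonneg_left ih (by linarith)

lemma tendsto_minimizer (h : GradientRun T b ρ β η x) (hs : cubicGrad T b ρ s = 0)
    (hm : ∀ z, m * ‖z‖ ^ 2 ≤ ⟪z, T z⟫_ℝ) (hgap : 0 < ρ * ‖s‖ + m) (hv : ‖v‖ = 1)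
    (hTv : T v = m • v) (hb : ⟪v, b⟫_ℝ ≠ 0) : Filter.Tendsto x Filter.atTop (nhds s) := by
  have hηg := h.η_mul_gap_le hs hv hTv
  have hpos := mul_pos h.η_pos hgap
  obtain ⟨t₀, ht₀⟩ := exists_nat_ge (tauGrow m ρ ⟪v, b⟫_ℝ / (η * (ρ * ‖s‖ + m)))
  have hshift := h.neg_le_shifted hv hTv hb hgap (by linarith) ((div_le_iff₀ hpos).1 ht₀)
  have hpow : Filter.Tendsto (fun k => (1 - η * (ρ * ‖s‖ + m) / 2) ^ k * ‖x t₀ - s‖ ^ 2)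
      Filter.atTop (nhds 0) := by
    simpa only [zero_mul] using (tendsto_pow_atTop_nhds_zero_of_lt_one
      (r := 1 - η * (ρ * ‖s‖ + m) / 2) (by linarith) (by linarith)).mul_const (‖x t₀ - s‖ ^ 2)
  have hsq : Filter.Tendsto (fun k => ‖x (t₀ + k) - s‖ ^ 2) Filter.atTop (nhds 0) :=
    squeeze_zero (fun _ => sq_nonneg _)
      (h.norm_sq_sub_le_pow hs hm hgap.le (by linarith) hshift) hpow
  rw [← Filter.tendsto_add_atTop_iff_nat t₀, tendsto_iff_norm_sub_tendsto_zero]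
  simpa only [Real.sqrt_sq (norm_nonneg _), Real.sqrt_zero, add_comm t₀] using hsq.sqrt

lemma norm_le_norm_minimizer (h : GradientRun T b ρ β η x) (hs : cubicGrad T b ρ s = 0)
    (hm : ∀ z, m * ‖z‖ ^ 2 ≤ ⟪z, T z⟫_ℝ) (hgap : 0 < ρ * ‖s‖ + m) (hv : ‖v‖ = 1)
    (hTv : T v = m • v) (hb : ⟪v, b⟫_ℝ ≠ 0) (t : ℕ) : ‖x t‖ ≤ ‖s‖ :=
  h.norm_monotone.ge_of_tendsto (h.tendsto_minimizer hs hm hgap hv hTv hb).norm t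

lemma cubicModel_le_of_linear_rate (h : GradientRun T b ρ β η x) (hs : cubicGrad T b ρ s = 0)
    (hm : ∀ z, m * ‖z‖ ^ 2 ≤ ⟪z, T z⟫_ℝ) (hgap : 0 ≤ ρ * ‖s‖ + m)
    (hηg : η * (ρ * ‖s‖ + m) ≤ 1) (hxs : ∀ t, ‖x t‖ ≤ ‖s‖) {ε : ℝ} (hε : 0 < ε)
    (hlarge : 2 * ε < (β + 2 * ρ * ‖s‖) * ‖s‖ ^ 2) {t₀ k : ℕ}
    (ht₀ : -((ρ * ‖s‖ + m) / 3) ≤ ρ * ‖x t₀‖ + m)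
    (hk : tauConverge β ρ ‖s‖ ε - 1 ≤ k * (η * (ρ * ‖s‖ + m))) :
    cubicModel T b ρ (x (t₀ + k)) ≤ cubicModel T b ρ s + ε := by
  have hρ := h.ρ_pos
  have hβ : 0 ≤ β := (norm_nonneg T).trans h.opNorm_le
  have hτ := four_le_tauConverge hε hlarge
  have hmodel := cubicModel_le_of_norm_le h.symm hρ.le h.opNorm_le hs (hxs (t₀ + k))
  have hpow := h.norm_sq_sub_le_pow hs hm hgap hηg ht₀ k
  set K := (β + 2 * ρ * ‖s‖) * ‖s‖ ^ 2 with hK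
  have hKpos : 0 < K := by linarith
  have hlog : Real.log (2 * (K / ε)) ≤ k * (η * (ρ * ‖s‖ + m) / 2) := by
    rw [Real.log_mul two_ne_zero (by positivity)]
    rw [tauConverge, ← hK] at hk hτ
    linarith [Real.log_two_lt_d9]
  refine hmodel.trans (add_le_add_right ?_ _)
  calc 1 / 2 * (β + 2 * ρ * ‖s‖) * ‖x (t₀ + k) - s‖ ^ 2
      ≤ 1 / 2 * (β + 2 * ρ * ‖s‖) * ((2 * (K / ε))⁻¹ * (4 * ‖s‖ ^ 2)) := by
        gcongr
        exact hpow.trans (mul_le_mul (one_sub_pow_le_inv (by linarith) (by positivity) hlog)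
          (norm_sub_sq_le_four_mul (hxs t₀)) (by positivity) (by positivity))
    _ = (K / ε)⁻¹ * K := by rw [hK, mul_inv]; ring
    _ = ε := by field_simp

/-! ### Sublinear convergence -/

lemma cubicModel_succ_add_le (h : GradientRun T b ρ β η x) (t : ℕ) :
    cubicModel T b ρ (x (t + 1)) + 3 / 4 * η * ‖cubicGrad T b ρ (x t)‖ ^ 2
      ≤ cubicModel T b ρ (x t) := by
  have hR := h.norm_le_trapRadius (t + 1)
  rw [h.step] at hR ⊢
  exact cubicModel_sub_smul_cubicGrad_le h.symm h.ρ_pos.le h.opNorm_le h.η_pos.le h.η_le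
    (h.norm_le_trapRadius t) hR

lemma cubicModel_succ_le (h : GradientRun T b ρ β η x) (t : ℕ) :
    cubicModel T b ρ (x (t + 1)) ≤ cubicModel T b ρ (x t) := by
  have hη := h.η_pos
  exact (le_add_of_nonneg_right (by positivity)).trans (h.cubicModel_succ_add_le t)

/-- While the optimality gap exceeds `ε`, the model is nearly convex between `x t` and `s`, so the
squared distance to `s` decreases by a fixed amount. -/
lemma norm_sq_sub_succ_le (h : GradientRun T b ρ β η x)
    (hs : ∀ z, cubicModel T b ρ s ≤ cubicModel T b ρ z) (hm : ∀ z, m * ‖z‖ ^ 2 ≤ ⟪z, T z⟫_ℝ)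
    {t : ℕ} (hxs : ‖x t‖ ≤ ‖s‖) {ε δ : ℝ} (hδ : 0 ≤ δ) (hδε : 30 * δ * ‖s‖ ^ 2 ≤ ε)
    (hshift : -δ ≤ ρ * ‖x t‖ + m) (hgap : cubicModel T b ρ s + ε < cubicModel T b ρ (x t)) :
    ‖x (t + 1) - s‖ ^ 2 ≤ ‖x t - s‖ ^ 2 - 8 / 15 * η * ε := by
  have hη := h.η_pos
  have hρ := h.ρ_pos
  have hgrad := cubicGrad_eq_zero_of_forall_le h.symm hs
  have hdecrease := h.cubicModel_succ_add_le t
  have hcurv : -(ε / 15) * 2 ≤ ⟪x t - s, T (x t - s)⟫_ℝ + ρ * ‖x t‖ * ‖x t - s‖ ^ 2 :=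
    calc -(ε / 15) * 2 ≤ -δ * (4 * ‖s‖ ^ 2) := by linarith
      _ ≤ -δ * ‖x t - s‖ ^ 2 :=
          mul_le_mul_of_nonpos_left (norm_sub_sq_le_four_mul hxs) (neg_nonpos.2 hδ)
      _ ≤ (ρ * ‖x t‖ + m) * ‖x t - s‖ ^ 2 := by gcongr
      _ ≤ ⟪x t - s, T (x t - s)⟫_ℝ + ρ * ‖x t‖ * ‖x t - s‖ ^ 2 := by linarith [hm (x t - s)]
  have hcubic : 0 ≤ ρ * (‖s‖ - ‖x t‖) ^ 2 * (2 * ‖s‖ + ‖x t‖) := by positivity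
  have hnearConvex : cubicModel T b ρ (x t) - cubicModel T b ρ s - ε / 15
      ≤ ⟪x t - s, cubicGrad T b ρ (x t)⟫_ℝ := by
    rw [inner_sub_cubicGrad hgrad, cubicModel_eq_of_cubicGrad_eq_zero h.symm hgrad (x t)]
    linarith
  have hdrop : η * (8 / 15 * ε) ≤
      η * (2 * ⟪x t - s, cubicGrad T b ρ (x t)⟫_ℝ - η * ‖cubicGrad T b ρ (x t)‖ ^ 2) :=
    mul_le_mul_of_nonneg_left (by linarith [hs (x (t + 1))]) hη.le
  rw [h.step, sub_right_comm, norm_sub_smul_sq]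
  linarith

lemma norm_sq_sub_le_sub_mul (h : GradientRun T b ρ β η x)
    (hs : ∀ z, cubicModel T b ρ s ≤ cubicModel T b ρ z) (hm : ∀ z, m * ‖z‖ ^ 2 ≤ ⟪z, T z⟫_ℝ)
    (hxs : ∀ t, ‖x t‖ ≤ ‖s‖) {ε δ : ℝ} (hδ : 0 ≤ δ) (hδε : 30 * δ * ‖s‖ ^ 2 ≤ ε) {t₀ k : ℕ}
    (ht₀ : -δ ≤ ρ * ‖x t₀‖ + m)
    (hgap : cubicModel T b ρ s + ε < cubicModel T b ρ (x (t₀ + k))) :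
    ‖x (t₀ + k) - s‖ ^ 2 ≤ ‖x t₀ - s‖ ^ 2 - k * (8 / 15 * η * ε) := by
  induction k with
  | zero => rw [Nat.cast_zero, zero_mul, sub_zero, add_zero]
  | succ k ih =>
    have hgap' := hgap.trans_le (h.cubicModel_succ_le (t₀ + k))
    have hgrow : ρ * ‖x t₀‖ ≤ ρ * ‖x (t₀ + k)‖ :=
      mul_le_mul_of_nonneg_left (h.norm_monotone (Nat.le_add_right t₀ k)) h.ρ_pos.le
    have hdrop := h.norm_sq_sub_succ_le hs hm (hxs (t₀ + k)) hδ hδε (by linarith) hgap'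
    rw [← add_assoc]
    push_cast
    linarith [ih hgap']

lemma η_mul_div_le (h : GradientRun T b ρ β η x) (hs : cubicGrad T b ρ s = 0) (hs₀ : s ≠ 0)
    {ε : ℝ} (hlarge : 2 * ε < (β + 2 * ρ * ‖s‖) * ‖s‖ ^ 2) :
    η * (ε / (10 * ‖s‖ ^ 2)) ≤ 1 := by
  have hn : 0 < ‖s‖ := norm_pos_iff.2 hs₀
  have hβ : 0 ≤ β := (norm_nonneg T).trans h.opNorm_le
  have hR : ρ * ‖s‖ ≤ ρ * trapRadius β ρ b :=
    mul_le_mul_of_nonneg_left (h.norm_criticalPoint_le hs) h.ρ_pos.le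
  have hR₀ : 0 ≤ ρ * ‖s‖ := mul_nonneg h.ρ_pos.le hn.le
  have hle : ε / (10 * ‖s‖ ^ 2) ≤ 4 * (β + ρ * trapRadius β ρ b) := by
    rw [div_le_iff₀ (by positivity)]
    calc ε ≤ (β + ρ * ‖s‖) * ‖s‖ ^ 2 := by
          linarith [mul_nonneg hβ (sq_nonneg ‖s‖)]
      _ ≤ (β + ρ * trapRadius β ρ b) * ‖s‖ ^ 2 := by gcongr
      _ ≤ 4 * (β + ρ * trapRadius β ρ b) * (10 * ‖s‖ ^ 2) := by
          linarith [mul_nonneg (hβ.trans (le_add_of_nonneg_right (hR₀.trans hR))) (sq_nonneg ‖s‖)]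
  linarith [mul_le_mul_of_nonneg_left hle h.η_pos.le, h.η_le]

/-- The rate does not depend on the spectral gap: as long as the optimality gap exceeds `ε`, every
step takes a fixed amount off the squared distance to `s`, which is at most `4‖s‖²`. -/
lemma cubicModel_le_of_sublinear_rate (h : GradientRun T b ρ β η x)
    (hs : ∀ z, cubicModel T b ρ s ≤ cubicModel T b ρ z) (hs₀ : s ≠ 0)
    (hm : ∀ z, m * ‖z‖ ^ 2 ≤ ⟪z, T z⟫_ℝ) (hxs : ∀ t, ‖x t‖ ≤ ‖s‖) {ε : ℝ} (hε : 0 ≤ ε)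
    {t₀ k : ℕ} (ht₀ : -(ε / (10 * ‖s‖ ^ 2) / 3) ≤ ρ * ‖x t₀‖ + m)
    (hk : 1 ≤ k * (η * (ε / (10 * ‖s‖ ^ 2)))) :
    cubicModel T b ρ (x (t₀ + k)) ≤ cubicModel T b ρ s + ε := by
  by_contra! hgap
  have hn : 0 < ‖s‖ := norm_pos_iff.2 hs₀
  have hdist := h.norm_sq_sub_le_sub_mul hs hm hxs (δ := ε / (10 * ‖s‖ ^ 2) / 3) (by positivity)
    (by field_simp; linarith) ht₀ hgap
  have hdrop : 4 * ‖s‖ ^ 2 < k * (8 / 15 * η * ε) :=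
    calc 4 * ‖s‖ ^ 2 < 16 / 3 * ‖s‖ ^ 2 * 1 := by linarith [pow_pos hn 2]
      _ ≤ 16 / 3 * ‖s‖ ^ 2 * (k * (η * (ε / (10 * ‖s‖ ^ 2)))) := by gcongr
      _ = k * (8 / 15 * η * ε) := by
          field_simp
          ring
  linarith [norm_sub_sq_le_four_mul (hxs t₀), sq_nonneg ‖x (t₀ + k) - s‖]

end GradientRun

lemma gradientRun_of_le_lineRadius (hT : T.IsSymmetric) (hβ : ‖T‖ ≤ β) (hρ : 0 < ρ) (hb : b ≠ 0)
    {r : ℝ} (hr₀ : 0 ≤ r) (hr : r ≤ lineRadius T b ρ) (hη₀ : 0 < η)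
    (hη : η ≤ 1 / (4 * (β + ρ * trapRadius β ρ b))) (hx₀ : x 0 = -(r / ‖b‖) • b)
    (hx : ∀ t, x (t + 1) = x t - η • cubicGrad T b ρ (x t)) : GradientRun T b ρ β η x where
  symm := hT
  opNorm_le := hβ
  ρ_pos := hρ
  η_pos := hη₀
  η_le := by
    have hβ₀ : 0 ≤ β := (norm_nonneg T).trans hβ
    have hR := trapRadius_pos hβ₀ hρ hb
    rw [le_div_iff₀ (by positivity)] at hη
    linarith
  exists_start := ⟨r / ‖b‖, by positivity, hx₀⟩
  start_nonpos := hx₀ ▸ inner_cubicGrad_nonpos_of_le_lineRadius hρ hb hr₀ hr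
  step := hx

end Run

/-! ### Matrices -/

section Matrices

variable {d : ℕ} {A : Matrix (Fin d) (Fin d) ℝ}

lemma isSymmetric_op (hA : A.IsSymm) : (op A).IsSymmetric :=
  Matrix.isSymmetric_toEuclideanLin_iff.2 <| by
    rw [Matrix.IsHermitian, Matrix.conjTranspose_eq_transpose_of_trivial]
    exact hA

lemma IsMinEigenvalue.mul_norm_sq_le {μ : ℝ} (hμ : IsMinEigenvalue A μ) (hA : A.IsSymm)
    (z : EuclideanSpace ℝ (Fin d)) : μ * ‖z‖ ^ 2 ≤ ⟪z, op A z⟫_ℝ :=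
  have hT := isSymmetric_op hA
  mul_norm_sq_le_inner_apply hT (hT.apply_eigenvectorBasis rfl)
    (fun i => hμ.2 (hT.hasEigenvalue_eigenvalues rfl i)) z

lemma gradientDescent_succ (hA : A.IsSymm) (b : EuclideanSpace ℝ (Fin d)) (ρ η : ℝ)
    (x₀ : EuclideanSpace ℝ (Fin d)) (t : ℕ) :
    gradientDescent (objective A b ρ) η x₀ (t + 1) = gradientDescent (objective A b ρ) η x₀ t
      - η • cubicGrad (op A) b ρ (gradientDescent (objective A b ρ) η x₀ t) := by
  have hgrad := (hasGradientAt_cubicModel (isSymmetric_op hA) b ρ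
    (gradientDescent (objective A b ρ) η x₀ t)).gradient
  rw [← hgrad]
  rfl

end Matrices

end CubicGD

open CubicGD

theorem theorem3p1_general {E : Type*} [NormedAddCommGroup E] [InnerProductSpace ℝ E]
    {T : E →L[ℝ] E} (hT : T.IsSymmetric) {b : E} {ρ β : ℝ} (hρ : 0 < ρ) (hβ : ‖T‖ ≤ β)
    {m : ℝ} (hm : ∀ z, m * ‖z‖ ^ 2 ≤ ⟪z, T z⟫_ℝ) {v : E} (hv : ‖v‖ = 1) (hTv : T v = m • v)
    (hb : ⟪v, b⟫_ℝ ≠ 0) {s : E} (hs : ∀ z, cubicModel T b ρ s ≤ cubicModel T b ρ z)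
    {r : ℝ} (hr₀ : 0 ≤ r) (hr : r ≤ lineRadius T b ρ)
    {η : ℝ} (hη₀ : 0 < η) (hη : η ≤ 1 / (4 * (β + ρ * trapRadius β ρ b)))
    {x : ℕ → E} (hx₀ : x 0 = -(r / ‖b‖) • b)
    (hx : ∀ t, x (t + 1) = x t - η • cubicGrad T b ρ (x t)) {ε : ℝ} (hε : 0 < ε) {t : ℕ}
    (ht : (tauGrow m ρ ⟪v, b⟫_ℝ + tauConverge β ρ ‖s‖ ε) / η
      * min (1 / (ρ * ‖s‖ + m)) (10 * ‖s‖ ^ 2 / ε) ≤ t) :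
    cubicModel T b ρ (x t) ≤ cubicModel T b ρ s + ε := by
  have hb₀ : b ≠ 0 := fun h => hb (by rw [h, inner_zero_right])
  have hrun := gradientRun_of_le_lineRadius hT hβ hρ hb₀ hr₀ hr hη₀ hη hx₀ hx
  have hgrad := cubicGrad_eq_zero_of_forall_le hT hs
  have hgap := shifted_eigenvalue_pos hT hs hv hTv hb
  have hηg := hrun.η_mul_gap_le hgrad hv hTv
  have hxs := hrun.norm_le_norm_minimizer hgrad hm hgap hv hTv hb
  rcases le_or_gt ((β + 2 * ρ * ‖s‖) * ‖s‖ ^ 2) (2 * ε) with hsmall | hlarge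
  · linarith [cubicModel_nonpos hρ.le (hrun.inner_nonpos t) (hrun.inner_cubicGrad_nonpos t),
      neg_cubicModel_le hT hρ.le hβ hgrad]
  have hτ := four_le_tauConverge hε hlarge
  have hs₀ : s ≠ 0 := by
    rintro rfl
    rw [norm_zero, zero_pow two_ne_zero, mul_zero] at hlarge
    linarith
  rcases min_choice (1 / (ρ * ‖s‖ + m)) (10 * ‖s‖ ^ 2 / ε) with hmin | hmin <;> rw [hmin] at ht
  · obtain ⟨t₀, k, rfl, ht₀, hk⟩ := hrun.exists_growth_stage hv hTv hb hgap (by linarith)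
      (by linarith) (le_mul_of_div_mul_inv_le hη₀ hgap (one_div (ρ * ‖s‖ + m) ▸ ht))
    exact hrun.cubicModel_le_of_linear_rate hgrad hm hgap.le (by linarith) hxs hε hlarge ht₀ hk
  · rw [← inv_div ε] at ht
    have hrate : 0 < ε / (10 * ‖s‖ ^ 2) := by positivity
    obtain ⟨t₀, k, rfl, ht₀, hk⟩ := hrun.exists_growth_stage hv hTv hb hrate
      (hrun.η_mul_div_le hgrad hs₀ hlarge) (by linarith) (le_mul_of_div_mul_inv_le hη₀ hrate ht)
    exact hrun.cubicModel_le_of_sublinear_rate hs hs₀ hm hxs hε.le ht₀ (by linarith)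

theorem theorem3p1 {d : ℕ}
    -- the problem data: a symmetric matrix `A`, a vector `b`, and `ρ > 0`
    (A : Matrix (Fin d) (Fin d) ℝ) (hA : A.IsSymm)
    (b : EuclideanSpace ℝ (Fin d)) (ρ : ℝ) (hρ : 0 < ρ)
    -- any upper bound on `‖A‖_op`, in particular `β = ‖A‖_op`
    (β : ℝ) (hβ : ‖CubicGD.op A‖ ≤ β)
    -- the smallest eigenvalue and a corresponding unit eigenvector
    (lamMin : ℝ) (hlam : CubicGD.IsMinEigenvalue A lamMin)
    (vMin : EuclideanSpace ℝ (Fin d)) (hv : ‖vMin‖ = 1)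
    (hAv : CubicGD.op A vMin = lamMin • vMin)
    (hb : inner ℝ vMin b ≠ 0)
    -- a global minimizer
    (s : EuclideanSpace ℝ (Fin d))
    (hs : ∀ x, CubicGD.objective A b ρ s ≤ CubicGD.objective A b ρ x)
    -- initialization and step size
    (r : ℝ) (hr₀ : 0 ≤ r) (hr : r ≤ CubicGD.cauchyRadius A b ρ)
    (η : ℝ) (hη₀ : 0 < η) (hη : η ≤ 1 / (4 * (β + ρ * CubicGD.upperRadius β ρ b)))
    (ε : ℝ) (hε : 0 < ε)
    (t : ℕ)
    (ht : (CubicGD.tauGrow lamMin ρ (inner ℝ vMin b) + CubicGD.tauConverge β ρ ‖s‖ ε) / η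
        * min (1 / (ρ * ‖s‖ + lamMin)) (10 * ‖s‖ ^ 2 / ε) ≤ (t : ℝ)) :
    CubicGD.objective A b ρ
        (CubicGD.gradientDescent (CubicGD.objective A b ρ) η (-(r / ‖b‖) • b) t)
      ≤ CubicGD.objective A b ρ s + ε := by
  exact theorem3p1_general (isSymmetric_op hA) hρ hβ (hlam.mul_norm_sq_le hA) hv hAv hb hs hr₀ hr
    hη₀ hη rfl (gradientDescent_succ hA b ρ η _) hε ht
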